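/- All spaces are complex. A Banach algebra $A$ (not necessarily unital) has a submultiplicative complete norm; in the operator version $A$ is a completely contractive (c.c.) Banach algebra, i.e. a complete operator space with $\|[a_{ij}b_{kl}]\|\le\|[a_{ij}]\|\,\|[b_{kl}]\|$ for all matrices over $A$. A homogeneous left dual Banach algebra (HLDBA) over $A$ is a pair $(\mathfrak A,\eta)$, where $\mathfrak A$ is a Banach algebra with a fixed Banach space predual $\mathfrak A_*$ (so $\mathfrak A=(\mathfrak A_*)^*$ isometrically), such that $\mu\mapsto\mu\nu$ is weak*-continuous on $\mathfrak A$ for every $\nu\in\mathfrak A$, and $\eta:A\to\mathfrak A$ is a contractive homomorphism with weak*-dense range such that $\nu\mapsto\eta(a)\nu$ is weak*-continuous for every $a\in A$. An operator HLDBA over a c.c. Banach algebra $A$ is defined in the same way, with $\mathfrak A$ a c.c. Banach algebra that is the operator space dual of an operator space $\mathfrak A_*$, and with $\eta$ completely contractive. Write $(\mathfrak B,\eta_{\mathfrak B})\le(\mathfrak A,\eta_{\mathfrak A})$ if there is a weak*-continuous linear (complete) contraction $\Phi:\mathfrak A\to\mathfrak B$ with $\Phi\circ\eta_{\mathfrak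 A}=\eta_{\mathfrak B}$, and $(\mathfrak A,\eta_{\mathfrak A})\cong(\mathfrak B,\eta_{\mathfrak B})$ if moreover $\Phi$ can be chosen to be a surjective (complete) isometry. Up to $\cong$ the (operator) HLDBAs over $A$ form a set, denoted $\mathcal{HLD}(A)$, on which $\le$ is well defined. Let $\{(\mathfrak A_i,\eta_i)\}_{i\in I}$ be a family of (operator) HLDBAs over $A$. Its $\ell^\infty$-product $\prod_i\mathfrak A_i$, with coordinatewise operations, the norm $\sup_i\|\mu_i\|$ (and the matrix norms $\sup_i\|[\mu_{kl}(i)]\|$), is the dual of the $\ell^1$-sum of the spaces $(\mathfrak A_i)_*$. Let $\eta_\vee(a)=(\eta_i(a))_{i\in I}$, and let $\mathfrak A_\vee$ be the weak*-closure of $\eta_\vee(A)$ in $\prod_i\mathfrak A_i$. Theorem. In the Banach algebra version and in the operator version alike: 1. $(\mathfrak A_\vee,\eta_\vee)$, with the product, the (matrix) norm and the weak*-topology inherited from $\prod_i\mathfrak A_i$, is an (operator) HLDBA over $A$ (the subdirect product of the family), and it is the supremum of $\{(\mathfrak A_i,\eta_i): i\in I\}$ in $(\mathcal{HLD}(A),\le)$.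 2. $(\mathcal{HLD}(A),\le)$ is a complete lattice. Its maximum is $A^{**}$, with the first Arens product ($\langle\mu\mathbin\square\nu,\phi\rangle=\langle\mu,\nu\mathbin\square\phi\rangle$, $\langle\nu\mathbin\square\phi,a\rangle=\langle\nu,\phi\cdot a\rangle$, $\langle\phi\cdot a,b\rangle=\langle\phi,ab\rangle$ for $\mu,\nu\in A^{**}$, $\phi\in A^*$, $a,b\in A$), the predual $A^*$ and the canonical embedding $A\to A^{**}$; its minimum is the trivial algebra $\{0\}$. -/

import Mathlib

open scoped ENNReal Topology

universe u v w

noncomputable section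

/-! ### Operator spaces -/

/-- The operator norm of a rectangular complex matrix, acting between Euclidean spaces. -/
def scalarOpNorm {m n : Type*} [Fintype m] [Fintype n] [DecidableEq n] (α : Matrix m n ℂ) : ℝ :=
  ‖(Matrix.toEuclideanLin α).toContinuousLinearMap‖

/-- An (abstract) operator space structure on a normed space: norms on all `M_n(E)` that satisfy
Ruan's axioms and extend the norm of `E = M_1(E)`. -/
class OperatorSpace (E : Type*) [NormedAddCommGroup E] [NormedSpace ℂ E] where
  /-- the norm on `M_n(E)` -/
  mnorm : {n : ℕ} → Matrix (Fin n) (Fin n) E → ℝ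
  mnorm_one : ∀ x : E, mnorm (n := 1) (Matrix.of fun _ _ => x) = ‖x‖
  mnorm_add_le : ∀ {n : ℕ} (x y : Matrix (Fin n) (Fin n) E), mnorm (x + y) ≤ mnorm x + mnorm y
  mnorm_smul : ∀ {n : ℕ} (c : ℂ) (x : Matrix (Fin n) (Fin n) E), mnorm (c • x) = ‖c‖ * mnorm x
  eq_zero_of_mnorm_eq_zero : ∀ {n : ℕ} (x : Matrix (Fin n) (Fin n) E), mnorm x = 0 → x = 0
  /-- `‖x ⊕ y‖ = max ‖x‖ ‖y‖` -/
  mnorm_directSum : ∀ {m n : ℕ} (x : Matrix (Fin m) (Fin m) E) (y : Matrix (Fin n) (Fin n) E),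
    mnorm ((Matrix.fromBlocks x 0 0 y).submatrix finSumFinEquiv.symm finSumFinEquiv.symm)
      = max (mnorm x) (mnorm y)
  /-- `‖α x β‖ ≤ ‖α‖ ‖x‖ ‖β‖` -/
  mnorm_mul_le : ∀ {m n : ℕ} (α : Matrix (Fin n) (Fin m) ℂ) (x : Matrix (Fin m) (Fin m) E)
    (β : Matrix (Fin m) (Fin n) ℂ),
    mnorm (Matrix.of fun i j => ∑ k, ∑ l, (α i k * β l j) • x k l)
      ≤ scalarOpNorm α * mnorm x * scalarOpNorm β

open OperatorSpace

/-- The dual operator space norm on `M_n(E*)`: the completely bounded norm of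
`[f_{kl}] : E → M_n(ℂ)`. -/
def dualMNorm {E : Type*} [NormedAddCommGroup E] [NormedSpace ℂ E] [OperatorSpace E] {n : ℕ}
    (f : Matrix (Fin n) (Fin n) (StrongDual ℂ E)) : ℝ :=
  sSup {r : ℝ | ∃ (m : ℕ) (x : Matrix (Fin m) (Fin m) E), mnorm x ≤ 1 ∧
    r = scalarOpNorm (Matrix.of fun p q : Fin n × Fin m => f p.1 q.1 (x p.2 q.2))}

theorem mnorm_nonneg {E : Type*} [NormedAddCommGroup E] [NormedSpace ℂ E] [OperatorSpace E]
    {n : ℕ} (x : Matrix (Fin n) (Fin n) E) : 0 ≤ mnorm x := by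
  have h0 : mnorm (0 : Matrix (Fin n) (Fin n) E) = 0 := by
    simpa using mnorm_smul (0 : ℂ) (0 : Matrix (Fin n) (Fin n) E)
  have h1 : mnorm (-x) = mnorm x := by simpa using mnorm_smul (-1 : ℂ) x
  have h2 := mnorm_add_le x (-x)
  rw [add_neg_cancel, h0, h1] at h2
  linarith

theorem dualMNorm_of_subsingleton {E : Type*} [NormedAddCommGroup E] [NormedSpace ℂ E]
    [OperatorSpace E] (hE : Subsingleton E) {n : ℕ}
    (f : Matrix (Fin n) (Fin n) (StrongDual ℂ E)) : dualMNorm f = 0 := by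
  have h : ∀ r ∈ {r : ℝ | ∃ (m : ℕ) (x : Matrix (Fin m) (Fin m) E), mnorm x ≤ 1 ∧
      r = scalarOpNorm (Matrix.of fun p q : Fin n × Fin m => f p.1 q.1 (x p.2 q.2))}, r = 0 := by
    rintro r ⟨m, x, -, rfl⟩
    have : (Matrix.of fun p q : Fin n × Fin m => f p.1 q.1 (x p.2 q.2)) = 0 := by
      ext p q
      rw [Matrix.of_apply, Subsingleton.elim (x p.2 q.2) 0, map_zero, Matrix.zero_apply]
    rw [this]
    simp [scalarOpNorm]
  exact le_antisymm (Real.sSup_nonpos fun r hr => (h r hr).le)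
    (Real.sSup_nonneg fun r hr => (h r hr).ge)

/-- Multiplication of `E` is a completely contractive bilinear map:
`‖[x_{ij} y_{kl}]‖ ≤ ‖x‖ ‖y‖` in `M_{mn}(E)` for `x ∈ M_m(E)`, `y ∈ M_n(E)`. -/
def CompletelyContractiveMul (E : Type*) [NonUnitalNormedRing E] [NormedSpace ℂ E]
    [OperatorSpace E] : Prop :=
  ∀ (m n : ℕ) (x : Matrix (Fin m) (Fin m) E) (y : Matrix (Fin n) (Fin n) E),
    mnorm (Matrix.of fun p q : Fin (m * n) =>
        x (finProdFinEquiv.symm p).1 (finProdFinEquiv.symm q).1 *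
          y (finProdFinEquiv.symm p).2 (finProdFinEquiv.symm q).2)
      ≤ mnorm x * mnorm y

/-! ### The weak-star topology of a space with a fixed predual -/

section WeakStar

variable {E V F W : Type*} [NormedAddCommGroup E] [NormedSpace ℂ E]
  [NormedAddCommGroup V] [NormedSpace ℂ V] [NormedAddCommGroup F] [NormedSpace ℂ F]
  [NormedAddCommGroup W] [NormedSpace ℂ W]

/-- The weak-star topology on `E`, where `V` is a predual of `E` through `d : E ≅ V*`. -/
@[reducible] def weakStar (d : E ≃ₗᵢ[ℂ] StrongDual ℂ V) : TopologicalSpace E :=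
  TopologicalSpace.induced (fun μ => StrongDual.toWeakDual (d μ)) inferInstance

theorem weakStar_eval (d : E ≃ₗᵢ[ℂ] StrongDual ℂ V) (v : V) :
    Continuous[weakStar d, inferInstance] (fun μ => d μ v) := by
  let := weakStar d
  exact (WeakDual.eval_continuous v).comp continuous_induced_dom

theorem weakStar_continuous_of_eval {X : Type*} [TopologicalSpace X]
    (d : E ≃ₗᵢ[ℂ] StrongDual ℂ V) (g : X → E) (h : ∀ v, Continuous fun x => d (g x) v) :
    Continuous[inferInstance, weakStar d] g := by
  let := weakStar d
  exact continuous_induced_rng.2 (WeakDual.continuous_of_continuous_eval h)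

theorem weakStar_functional (d : E ≃ₗᵢ[ℂ] StrongDual ℂ V) (ψ : E →ₗ[ℂ] ℂ)
    (hψ : Continuous[weakStar d, inferInstance] ψ) : ∃ v, ∀ μ, ψ μ = d μ v := by
  let ψ' : StrongDual ℂ (WeakDual ℂ V) :=
    { toFun := fun x => ψ (d.symm (WeakDual.toStrongDual x))
      map_add' := by intro x y; simp
      map_smul' := by intro c x; simp
      cont := by
        let := weakStar d
        refine hψ.comp (continuous_induced_rng.2 ?_)
        have : (fun x : WeakDual ℂ V => StrongDual.toWeakDual
            (d (d.symm (WeakDual.toStrongDual x)))) = id := by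
          funext x
          rw [LinearIsometryEquiv.apply_symm_apply]
          rfl
        exact (congrArg Continuous this).mpr continuous_id }
  obtain ⟨v, hv⟩ := LinearMap.dualEmbedding_surjective (topDualPairing ℂ V) ψ'
  refine ⟨v, fun μ => ?_⟩
  have h : d μ v = ψ (d.symm (d μ)) := DFunLike.congr_fun hv (StrongDual.toWeakDual (d μ))
  rw [h, LinearIsometryEquiv.symm_apply_apply]

/-- The inverse of a weak-star continuous isometric isomorphism is weak-star continuous. -/
theorem weakStar_symm [CompleteSpace W] (d : E ≃ₗᵢ[ℂ] StrongDual ℂ V)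
    (d' : F ≃ₗᵢ[ℂ] StrongDual ℂ W) (e : E ≃ₗᵢ[ℂ] F)
    (he : Continuous[weakStar d, weakStar d'] e) :
    Continuous[weakStar d', weakStar d] e.symm := by
  have hex : ∀ w : W, ∃ v : V, ∀ μ, d' (e μ) w = d μ v := fun w =>
    weakStar_functional d
      { toFun := fun μ => d' (e μ) w
        map_add' := by intro x y; simp
        map_smul' := by intro c x; simp }
      (by
        let := weakStar d
        let := weakStar d'
        exact (weakStar_eval d' w).comp he)
  choose T hT using hex
  have hsep : ∀ v v' : V, (∀ μ, d μ v = d μ v') → v = v' := by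
    intro v v' h
    rw [← sub_eq_zero]
    refine SeparatingDual.eq_zero_of_forall_dual_eq_zero (R := ℂ) fun f => ?_
    have := h (d.symm f)
    rw [LinearIsometryEquiv.apply_symm_apply] at this
    rw [map_sub, this, sub_self]
  have hnorm : ∀ w, ‖w‖ ≤ ‖T w‖ := by
    intro w
    refine NormedSpace.norm_le_dual_bound ℂ w (norm_nonneg _) fun f => ?_
    have h := hT w (e.symm (d'.symm f))
    rw [LinearIsometryEquiv.apply_symm_apply, LinearIsometryEquiv.apply_symm_apply] at h
    rw [h]
    refine ((d _).le_opNorm _).trans (le_of_eq ?_)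
    rw [LinearIsometryEquiv.norm_map, LinearIsometryEquiv.norm_map,
      LinearIsometryEquiv.norm_map, mul_comm]
  have hnorm' : ∀ w, ‖T w‖ ≤ ‖w‖ := by
    intro w
    refine NormedSpace.norm_le_dual_bound ℂ _ (norm_nonneg _) fun f => ?_
    have h := hT w (d.symm f)
    rw [LinearIsometryEquiv.apply_symm_apply] at h
    rw [← h]
    refine ((d' _).le_opNorm _).trans (le_of_eq ?_)
    rw [LinearIsometryEquiv.norm_map, LinearIsometryEquiv.norm_map,
      LinearIsometryEquiv.norm_map, mul_comm]
  let T' : W →ₗᵢ[ℂ] V :=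
    { toFun := T
      map_add' := fun x y => hsep _ _ fun μ => by rw [← hT, map_add, map_add, ← hT, ← hT]
      map_smul' := fun c x => hsep _ _ fun μ => by
        rw [← hT, map_smul, RingHom.id_apply, map_smul, ← hT]
      norm_map' := fun w => le_antisymm (hnorm' w) (hnorm w) }
  have hclosed : IsClosed (LinearMap.range T'.toLinearMap : Set V) :=
    T'.isometry.isClosedEmbedding.isClosed_range
  have hsurj : ∀ v, ∃ w, T w = v := by
    by_contra! hcon
    obtain ⟨v, hv⟩ := hcon
    have hmk : (LinearMap.range T'.toLinearMap).mkQ v ≠ 0 := by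
      rw [Submodule.mkQ_apply, Ne, Submodule.Quotient.mk_eq_zero]
      rintro ⟨w, hw⟩
      exact hv w hw
    obtain ⟨g, hg⟩ := SeparatingDual.exists_ne_zero (R := ℂ) hmk
    let f : StrongDual ℂ V := g ∘L (LinearMap.range T'.toLinearMap).mkQL
    have hzero : e (d.symm f) = 0 := by
      apply d'.injective
      ext w
      rw [hT, LinearIsometryEquiv.apply_symm_apply, map_zero]
      have : (LinearMap.range T'.toLinearMap).mkQ (T w) = 0 := by
        rw [Submodule.mkQ_apply, Submodule.Quotient.mk_eq_zero]
        exact ⟨w, rfl⟩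
      change g ((LinearMap.range T'.toLinearMap).mkQ (T w)) = 0
      rw [this, map_zero]
    have hf : f = 0 := by
      rw [← d.symm.map_eq_zero_iff, ← e.map_eq_zero_iff]
      exact hzero
    exact hg (DFunLike.congr_fun hf v)
  let := weakStar d'
  refine weakStar_continuous_of_eval d _ fun v => ?_
  obtain ⟨w, rfl⟩ := hsurj v
  have : (fun b => d (e.symm b) (T w)) = fun b => d' b w := by
    funext b
    rw [← hT, LinearIsometryEquiv.apply_symm_apply]
  rw [this]
  exact weakStar_eval d' w

end WeakStar

/-! ### Homogeneous left dual Banach algebras -/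

/-- The topological centre of a Banach algebra with a fixed predual: all `μ` for which
`ν ↦ μ ν` is weak-star continuous. -/
def topologicalCentre {E V : Type*} [NonUnitalNormedRing E] [NormedSpace ℂ E]
    [NormedAddCommGroup V] [NormedSpace ℂ V] (d : E ≃ₗᵢ[ℂ] StrongDual ℂ V) : Set E :=
  {μ | Continuous[weakStar d, weakStar d] fun ν => μ * ν}

/-- A homogeneous left dual Banach algebra over `A`. -/
structure HLDBA (A : Type u) [NonUnitalNormedRing A] [NormedSpace ℂ A] :
    Type (max u (v + 1)) where
  /-- the underlying Banach algebra -/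
  Carrier : Type v
  /-- the fixed predual -/
  Predual : Type v
  [ring : NonUnitalNormedRing Carrier]
  [normedSpace : NormedSpace ℂ Carrier]
  [isScalarTower : IsScalarTower ℂ Carrier Carrier]
  [smulCommClass : SMulCommClass ℂ Carrier Carrier]
  [completeSpace : CompleteSpace Carrier]
  [predualGroup : NormedAddCommGroup Predual]
  [predualSpace : NormedSpace ℂ Predual]
  [predualComplete : CompleteSpace Predual]
  /-- the identification of the algebra with the dual of its predual -/
  dual : Carrier ≃ₗᵢ[ℂ] StrongDual ℂ Predual
  mul_weakStar : ∀ ν : Carrier, Continuous[weakStar dual, weakStar dual] fun μ => μ * ν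
  /-- the homomorphism from `A` -/
  η : A →ₙₐ[ℂ] Carrier
  η_contractive : ∀ a, ‖η a‖ ≤ ‖a‖
  η_mem_centre : ∀ a, η a ∈ topologicalCentre dual
  η_dense : @Dense Carrier (weakStar dual) (Set.range η)

attribute [instance] HLDBA.ring HLDBA.normedSpace HLDBA.isScalarTower HLDBA.smulCommClass
  HLDBA.completeSpace HLDBA.predualGroup HLDBA.predualSpace HLDBA.predualComplete

/-- An operator homogeneous left dual Banach algebra over the completely contractive Banach
algebra `A`: the algebra and its predual are operator spaces, the algebra is the operator space
dual of its predual, and its product and `η` are completely contractive. -/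
structure OpHLDBA (A : Type u) [NonUnitalNormedRing A] [NormedSpace ℂ A] [OperatorSpace A] :
    Type (max u (v + 1)) extends HLDBA.{u, v} A where
  [opCarrier : OperatorSpace Carrier]
  [opPredual : OperatorSpace Predual]
  mnorm_eq_dual : ∀ {n : ℕ} (x : Matrix (Fin n) (Fin n) Carrier), mnorm x = dualMNorm (x.map dual)
  mul_cc : CompletelyContractiveMul Carrier
  η_cc : ∀ {n : ℕ} (x : Matrix (Fin n) (Fin n) A), mnorm (x.map η) ≤ mnorm x

attribute [instance] OpHLDBA.opCarrier OpHLDBA.opPredual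

section Order

variable {A : Type u} [NonUnitalNormedRing A] [NormedSpace ℂ A]

/-- `Φ` is a homomorphism of HLDBAs over `A`: a weak-star continuous contraction that intertwines
the maps from `A`. -/
structure HLDBA.IsHom (𝔄 : HLDBA.{u, v} A) (𝔅 : HLDBA.{u, w} A)
    (Φ : 𝔄.Carrier →ₗ[ℂ] 𝔅.Carrier) : Prop where
  contractive : ∀ x, ‖Φ x‖ ≤ ‖x‖
  weakStar : Continuous[weakStar 𝔄.dual, weakStar 𝔅.dual] Φ
  comp_η : ∀ a, Φ (𝔄.η a) = 𝔅.η a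

/-- `𝔅 ≤ 𝔄`: there is a homomorphism from `𝔄` to `𝔅`. -/
def HLDBA.Le (𝔅 : HLDBA.{u, w} A) (𝔄 : HLDBA.{u, v} A) : Prop :=
  ∃ Φ : 𝔄.Carrier →ₗ[ℂ] 𝔅.Carrier, 𝔄.IsHom 𝔅 Φ

/-- `𝔄 ≅ 𝔅`: there is a homomorphism from `𝔄` to `𝔅` that is a surjective isometry. -/
def HLDBA.Equiv (𝔄 : HLDBA.{u, v} A) (𝔅 : HLDBA.{u, w} A) : Prop :=
  ∃ Φ : 𝔄.Carrier →ₗ[ℂ] 𝔅.Carrier, 𝔄.IsHom 𝔅 Φ ∧ Function.Surjective Φ ∧ ∀ x, ‖Φ x‖ = ‖x‖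

theorem HLDBA.Le.refl (𝔄 : HLDBA.{u, v} A) : 𝔄.Le 𝔄 :=
  ⟨LinearMap.id, ⟨fun _ => le_rfl, @continuous_id _ (_root_.weakStar 𝔄.dual), fun _ => rfl⟩⟩

theorem HLDBA.IsHom.comp {𝔄 𝔅 ℭ : HLDBA.{u, v} A} {Φ : 𝔄.Carrier →ₗ[ℂ] 𝔅.Carrier}
    {Ψ : 𝔅.Carrier →ₗ[ℂ] ℭ.Carrier} (hΨ : 𝔅.IsHom ℭ Ψ) (hΦ : 𝔄.IsHom 𝔅 Φ) :
    𝔄.IsHom ℭ (Ψ ∘ₗ Φ) where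
  contractive x := (hΨ.contractive _).trans (hΦ.contractive x)
  weakStar := by
    let := _root_.weakStar 𝔄.dual
    let := _root_.weakStar 𝔅.dual
    let := _root_.weakStar ℭ.dual
    exact hΨ.weakStar.comp hΦ.weakStar
  comp_η a := by rw [LinearMap.comp_apply, hΦ.comp_η, hΨ.comp_η]

theorem HLDBA.Le.trans {𝔄 𝔅 ℭ : HLDBA.{u, v} A} (h : 𝔄.Le 𝔅) (h' : 𝔅.Le ℭ) : 𝔄.Le ℭ := by
  obtain ⟨Φ, hΦ⟩ := h
  obtain ⟨Ψ, hΨ⟩ := h'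
  exact ⟨Φ ∘ₗ Ψ, hΦ.comp hΨ⟩

theorem HLDBA.IsHom.exists_inverse {𝔄 : HLDBA.{u, v} A} {𝔅 : HLDBA.{u, w} A}
    {Φ : 𝔄.Carrier →ₗ[ℂ] 𝔅.Carrier} (h : 𝔄.IsHom 𝔅 Φ) (hs : Function.Surjective Φ)
    (hi : ∀ x, ‖Φ x‖ = ‖x‖) :
    ∃ Ψ : 𝔅.Carrier →ₗ[ℂ] 𝔄.Carrier, 𝔅.IsHom 𝔄 Ψ ∧ (∀ x, Ψ (Φ x) = x) ∧ ∀ y, Φ (Ψ y) = y := by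
  let e : 𝔄.Carrier ≃ₗᵢ[ℂ] 𝔅.Carrier := LinearIsometryEquiv.ofSurjective ⟨Φ, hi⟩ hs
  have he : ∀ x, e x = Φ x := fun _ => rfl
  refine ⟨e.symm.toLinearEquiv.toLinearMap, ⟨fun y => (e.symm.norm_map y).le,
    weakStar_symm 𝔄.dual 𝔅.dual e h.weakStar, fun a => ?_⟩, e.symm_apply_apply,
    e.apply_symm_apply⟩
  rw [← h.comp_η, ← he]
  exact e.symm_apply_apply _

theorem HLDBA.Equiv.refl (𝔄 : HLDBA.{u, v} A) : 𝔄.Equiv 𝔄 :=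
  ⟨LinearMap.id, ⟨fun _ => le_rfl, @continuous_id _ (_root_.weakStar 𝔄.dual), fun _ => rfl⟩,
    Function.surjective_id, fun _ => rfl⟩

theorem HLDBA.Equiv.symm {𝔄 : HLDBA.{u, v} A} {𝔅 : HLDBA.{u, w} A} (h : 𝔄.Equiv 𝔅) :
    𝔅.Equiv 𝔄 := by
  obtain ⟨Φ, hΦ, hs, hi⟩ := h
  obtain ⟨Ψ, hΨ, hl, hr⟩ := hΦ.exists_inverse hs hi
  exact ⟨Ψ, hΨ, fun x => ⟨Φ x, hl x⟩, fun y => by rw [← hi, hr]⟩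

theorem HLDBA.Equiv.trans {𝔄 𝔅 ℭ : HLDBA.{u, v} A} (h : 𝔄.Equiv 𝔅) (h' : 𝔅.Equiv ℭ) :
    𝔄.Equiv ℭ := by
  obtain ⟨Φ, hΦ, hs, hi⟩ := h
  obtain ⟨Ψ, hΨ, hs', hi'⟩ := h'
  exact ⟨Ψ ∘ₗ Φ, hΨ.comp hΦ, hs'.comp hs, fun x => (hi' _).trans (hi x)⟩

theorem HLDBA.Equiv.ge {𝔄 : HLDBA.{u, v} A} {𝔅 : HLDBA.{u, w} A} (h : 𝔄.Equiv 𝔅) : 𝔅.Le 𝔄 := by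
  obtain ⟨Φ, hΦ, -⟩ := h
  exact ⟨Φ, hΦ⟩

variable (A) in
/-- `HLD(A)`: the homogeneous left dual Banach algebras over `A`, up to equivalence. -/
def HLD : Type (u + 1) :=
  Quotient (⟨HLDBA.Equiv, HLDBA.Equiv.refl, HLDBA.Equiv.symm, HLDBA.Equiv.trans⟩ :
    Setoid (HLDBA.{u, u} A))

/-- The equivalence class of an HLDBA. -/
def HLDBA.toHLD (𝔄 : HLDBA.{u, u} A) : HLD A := Quotient.mk _ 𝔄

/-- The order of `HLD A`, induced by `HLDBA.Le` on representatives. -/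
def HLD.Le (x y : HLD A) : Prop :=
  Quotient.liftOn₂ x y HLDBA.Le fun _ _ _ _ h h' => propext
    ⟨fun k => h.ge.trans (k.trans h'.symm.ge), fun k => h.symm.ge.trans (k.trans h'.ge)⟩

instance : LE (HLD A) := ⟨HLD.Le⟩

/-! The operator space versions. -/

variable [OperatorSpace A]

/-- `Φ` is a homomorphism of operator HLDBAs over `A`: a weak-star continuous complete contraction
that intertwines the maps from `A`. -/
structure OpHLDBA.IsHom (𝔄 : OpHLDBA.{u, v} A) (𝔅 : OpHLDBA.{u, w} A)
    (Φ : 𝔄.Carrier →ₗ[ℂ] 𝔅.Carrier) : Prop where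
  isHom : 𝔄.toHLDBA.IsHom 𝔅.toHLDBA Φ
  cc : ∀ {n : ℕ} (x : Matrix (Fin n) (Fin n) 𝔄.Carrier), mnorm (x.map Φ) ≤ mnorm x

/-- `𝔅 ≤ 𝔄`: there is a homomorphism from `𝔄` to `𝔅`. -/
def OpHLDBA.Le (𝔅 : OpHLDBA.{u, w} A) (𝔄 : OpHLDBA.{u, v} A) : Prop :=
  ∃ Φ : 𝔄.Carrier →ₗ[ℂ] 𝔅.Carrier, 𝔄.IsHom 𝔅 Φ

/-- `𝔄 ≅ 𝔅`: there is a homomorphism from `𝔄` to `𝔅` that is a surjective complete isometry. -/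
def OpHLDBA.Equiv (𝔄 : OpHLDBA.{u, v} A) (𝔅 : OpHLDBA.{u, w} A) : Prop :=
  ∃ Φ : 𝔄.Carrier →ₗ[ℂ] 𝔅.Carrier, 𝔄.IsHom 𝔅 Φ ∧ Function.Surjective Φ ∧
    ∀ {n : ℕ} (x : Matrix (Fin n) (Fin n) 𝔄.Carrier), mnorm (x.map Φ) = mnorm x

theorem OpHLDBA.IsHom.comp {𝔄 𝔅 ℭ : OpHLDBA.{u, v} A} {Φ : 𝔄.Carrier →ₗ[ℂ] 𝔅.Carrier}
    {Ψ : 𝔅.Carrier →ₗ[ℂ] ℭ.Carrier} (hΨ : 𝔅.IsHom ℭ Ψ) (hΦ : 𝔄.IsHom 𝔅 Φ) :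
    𝔄.IsHom ℭ (Ψ ∘ₗ Φ) where
  isHom := hΨ.isHom.comp hΦ.isHom
  cc x := (hΨ.cc (x.map Φ)).trans (hΦ.cc x)

theorem OpHLDBA.Le.trans {𝔄 𝔅 ℭ : OpHLDBA.{u, v} A} (h : 𝔄.Le 𝔅) (h' : 𝔅.Le ℭ) : 𝔄.Le ℭ := by
  obtain ⟨Φ, hΦ⟩ := h
  obtain ⟨Ψ, hΨ⟩ := h'
  exact ⟨Φ ∘ₗ Ψ, hΦ.comp hΨ⟩

theorem OpHLDBA.Equiv.refl (𝔄 : OpHLDBA.{u, v} A) : 𝔄.Equiv 𝔄 :=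
  ⟨LinearMap.id, ⟨⟨fun _ => le_rfl, @continuous_id _ (_root_.weakStar 𝔄.dual), fun _ => rfl⟩,
    fun _ => le_rfl⟩, Function.surjective_id, fun _ => rfl⟩

theorem OpHLDBA.Equiv.symm {𝔄 : OpHLDBA.{u, v} A} {𝔅 : OpHLDBA.{u, w} A} (h : 𝔄.Equiv 𝔅) :
    𝔅.Equiv 𝔄 := by
  obtain ⟨Φ, hΦ, hs, hi⟩ := h
  have hnorm : ∀ x, ‖Φ x‖ = ‖x‖ := fun x => by
    rw [← mnorm_one, ← mnorm_one (E := 𝔄.Carrier), ← hi]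
    rfl
  obtain ⟨Ψ, hΨ, hl, hr⟩ := hΦ.isHom.exists_inverse hs hnorm
  have hi' : ∀ {n : ℕ} (y : Matrix (Fin n) (Fin n) 𝔅.Carrier), mnorm (y.map Ψ) = mnorm y := by
    intro n y
    rw [← hi]
    congr 1
    ext i j
    exact hr _
  exact ⟨Ψ, ⟨hΨ, fun y => (hi' y).le⟩, fun x => ⟨Φ x, hl x⟩, hi'⟩

theorem OpHLDBA.Equiv.trans {𝔄 𝔅 ℭ : OpHLDBA.{u, v} A} (h : 𝔄.Equiv 𝔅) (h' : 𝔅.Equiv ℭ) :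
    𝔄.Equiv ℭ := by
  obtain ⟨Φ, hΦ, hs, hi⟩ := h
  obtain ⟨Ψ, hΨ, hs', hi'⟩ := h'
  exact ⟨Ψ ∘ₗ Φ, hΨ.comp hΦ, hs'.comp hs, fun x => (hi' (x.map Φ)).trans (hi x)⟩

theorem OpHLDBA.Equiv.ge {𝔄 : OpHLDBA.{u, v} A} {𝔅 : OpHLDBA.{u, w} A} (h : 𝔄.Equiv 𝔅) :
    𝔅.Le 𝔄 := by
  obtain ⟨Φ, hΦ, -⟩ := h
  exact ⟨Φ, hΦ⟩

variable (A) in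
/-- The operator version of `HLD(A)`: the operator HLDBAs over `A`, up to equivalence. -/
def OpHLD : Type (u + 1) :=
  Quotient (⟨OpHLDBA.Equiv, OpHLDBA.Equiv.refl, OpHLDBA.Equiv.symm, OpHLDBA.Equiv.trans⟩ :
    Setoid (OpHLDBA.{u, u} A))

/-- The equivalence class of an operator HLDBA. -/
def OpHLDBA.toOpHLD (𝔄 : OpHLDBA.{u, u} A) : OpHLD A := Quotient.mk _ 𝔄

/-- The order of `OpHLD A`, induced by `OpHLDBA.Le` on representatives. -/
def OpHLD.Le (x y : OpHLD A) : Prop :=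
  Quotient.liftOn₂ x y OpHLDBA.Le fun _ _ _ _ h h' => propext
    ⟨fun k => h.ge.trans (k.trans h'.symm.ge), fun k => h.symm.ge.trans (k.trans h'.ge)⟩

instance : LE (OpHLD A) := ⟨OpHLD.Le⟩

end Order

/-! ### Subdirect products -/

section Subdirect

variable {A : Type u} [NonUnitalNormedRing A] [NormedSpace ℂ A] {I : Type w}

/-- The `ℓ^∞`-product of a family of HLDBAs. -/
abbrev HLDBA.Product (𝔄 : I → HLDBA.{u, v} A) : Type (max w v) :=
  lp (fun i => (𝔄 i).Carrier) ∞

/-- The weak-star topology on the `ℓ^∞`-product, which is the dual of the `ℓ¹`-sum of the preduals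
through the pairing `⟨μ, v⟩ = ∑ ⟨μ_i, v_i⟩`. -/
@[reducible] def HLDBA.productWeakStar (𝔄 : I → HLDBA.{u, v} A) :
    TopologicalSpace (HLDBA.Product 𝔄) :=
  TopologicalSpace.induced
    (fun μ (v : lp (fun i => (𝔄 i).Predual) 1) => ∑' i, (𝔄 i).dual (μ i) (v i))
    Pi.topologicalSpace

/-- The diagonal map `a ↦ (η_i(a))_i` from `A` to the `ℓ^∞`-product. -/
def HLDBA.diagonal (𝔄 : I → HLDBA.{u, v} A) (a : A) : HLDBA.Product 𝔄 :=
  ⟨fun i => (𝔄 i).η a, memℓp_infty ⟨‖a‖, by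
    rintro _ ⟨i, rfl⟩
    exact (𝔄 i).η_contractive a⟩⟩

/-- `j` identifies `𝔓` with the subdirect product of the family `𝔄`: the weak-star closure of the
diagonal image of `A` in the `ℓ^∞`-product, with the norm, the product, the weak-star topology
and the map from `A` that it inherits from there. -/
structure HLDBA.IsSubdirectEmbedding (𝔄 : I → HLDBA.{u, v} A) (𝔓 : HLDBA.{u, u} A)
    (j : 𝔓.Carrier →ₗᵢ[ℂ] HLDBA.Product 𝔄) : Prop where
  range_eq : Set.range j =
    @closure (HLDBA.Product 𝔄) (HLDBA.productWeakStar 𝔄) (Set.range (HLDBA.diagonal 𝔄))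
  map_mul : ∀ μ ν, j (μ * ν) = j μ * j ν
  weakStar_eq : weakStar 𝔓.dual = TopologicalSpace.induced j (HLDBA.productWeakStar 𝔄)
  map_η : ∀ a, j (𝔓.η a) = HLDBA.diagonal 𝔄 a

/-- `𝔓` is the subdirect product of the family `𝔄` of HLDBAs. -/
def HLDBA.IsSubdirectProduct (𝔄 : I → HLDBA.{u, v} A) (𝔓 : HLDBA.{u, u} A) : Prop :=
  ∃ j, HLDBA.IsSubdirectEmbedding 𝔄 𝔓 j

/-- `𝔓` is the subdirect product of the family `𝔄` of operator HLDBAs; the `ℓ^∞`-product has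
the matrix norms `‖x‖ = sup_i ‖x_i‖`. -/
def OpHLDBA.IsSubdirectProduct [OperatorSpace A] (𝔄 : I → OpHLDBA.{u, v} A)
    (𝔓 : OpHLDBA.{u, u} A) : Prop :=
  ∃ j, HLDBA.IsSubdirectEmbedding (fun i => (𝔄 i).toHLDBA) 𝔓.toHLDBA j ∧
    ∀ {n : ℕ} (x : Matrix (Fin n) (Fin n) 𝔓.Carrier),
      mnorm x = ⨆ i, mnorm (Matrix.of fun k l => (j (x k l) i : (𝔄 i).Carrier))

end Subdirect

/-! ### The bidual and the trivial algebra -/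

section Bidual

variable {A : Type u} [NonUnitalNormedRing A] [NormedSpace ℂ A] [IsScalarTower ℂ A A]
  [SMulCommClass ℂ A A]

/-- `(ν, φ) ↦ ν □ φ ∈ A*`, where `⟨ν □ φ, a⟩ = ⟨ν, φ · a⟩` and `⟨φ · a, b⟩ = ⟨φ, a b⟩`. -/
def arensAct (ν : StrongDual ℂ (StrongDual ℂ A)) : StrongDual ℂ A →L[ℂ] StrongDual ℂ A :=
  (ContinuousLinearMap.compL ℂ A (StrongDual ℂ A) ℂ ν) ∘L
    (((ContinuousLinearMap.compL ℂ A (A →L[ℂ] A) (StrongDual ℂ A)).flip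
        (ContinuousLinearMap.mul ℂ A)) ∘L
      (ContinuousLinearMap.compL ℂ A A ℂ))

theorem arensAct_apply (ν : StrongDual ℂ (StrongDual ℂ A)) (φ : StrongDual ℂ A) (a : A) :
    arensAct ν φ a = ν (φ ∘L ContinuousLinearMap.mul ℂ A a) := rfl

/-- The first Arens product on `A**`: `⟨μ □ ν, φ⟩ = ⟨μ, ν □ φ⟩`. -/
def arensMul (μ ν : StrongDual ℂ (StrongDual ℂ A)) : StrongDual ℂ (StrongDual ℂ A) :=
  μ ∘L arensAct ν

/-- `e` and `J` identify `𝔗` with `A**`, with its first Arens product, its predual `A*` and the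
canonical embedding of `A`. -/
structure HLDBA.IsBidualVia (𝔗 : HLDBA.{u, u} A) (e : 𝔗.Predual ≃ₗᵢ[ℂ] StrongDual ℂ A)
    (J : 𝔗.Carrier ≃ₗᵢ[ℂ] StrongDual ℂ (StrongDual ℂ A)) : Prop where
  pairing : ∀ μ v, J μ (e v) = 𝔗.dual μ v
  map_mul : ∀ μ ν, J (μ * ν) = arensMul (J μ) (J ν)
  map_η : ∀ a, J (𝔗.η a) = NormedSpace.inclusionInDoubleDual ℂ A a

/-- `𝔗` is the HLDBA `A**`. -/
def HLDBA.IsBidual (𝔗 : HLDBA.{u, u} A) : Prop := ∃ e J, 𝔗.IsBidualVia e J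

/-- `𝔗` is the operator HLDBA `A**`; its predual has the dual operator space structure of `A*`
(hence `𝔗` itself has that of `A**`). -/
def OpHLDBA.IsBidual [OperatorSpace A] (𝔗 : OpHLDBA.{u, u} A) : Prop :=
  ∃ e J, 𝔗.toHLDBA.IsBidualVia e J ∧
    ∀ {n : ℕ} (v : Matrix (Fin n) (Fin n) 𝔗.Predual), mnorm v = dualMNorm (v.map e)

end Bidual

section Trivial

/-- The zero Banach algebra. -/
@[reducible] def zeroRing : NonUnitalNormedRing PUnit.{u + 1} :=
  { PUnit.normedAddCommGroup, (inferInstance : NonUnitalRing PUnit.{u + 1}) with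
    norm_mul_le := fun _ _ => by simp }

@[reducible] def zeroNormedSpace : NormedSpace ℂ PUnit.{u + 1} where
  norm_smul_le := fun _ _ => by simp

/-- The zero operator space. -/
@[reducible] def zeroOperatorSpace :
    @OperatorSpace PUnit.{u + 1} PUnit.normedAddCommGroup zeroNormedSpace :=
  @OperatorSpace.mk PUnit.{u + 1} PUnit.normedAddCommGroup zeroNormedSpace (fun _ => 0)
    (fun _ => rfl) (fun _ _ => by simp) (fun _ _ => by simp) (fun _ _ => Subsingleton.elim _ _)
    (fun _ _ => by simp) (fun _ _ _ => by simp)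

variable (A : Type u) [NonUnitalNormedRing A] [NormedSpace ℂ A]

/-- The trivial algebra `{0}`, an HLDBA over `A`. -/
def HLDBA.trivial : HLDBA.{u, v} A :=
  letI := zeroRing.{v}
  letI := zeroNormedSpace.{v}
  { Carrier := PUnit.{v + 1}
    Predual := PUnit.{v + 1}
    dual :=
      { toFun := fun _ => 0
        invFun := fun _ => 0
        map_add' := fun _ _ => by simp
        map_smul' := fun _ _ => by simp
        left_inv := fun _ => rfl
        right_inv := fun _ => Subsingleton.elim _ _
        norm_map' := fun _ => by simp }
    mul_weakStar := fun _ => @continuous_of_const _ _ (_) (_) _ fun _ _ => rfl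
    η := 0
    η_contractive := fun a => by simp
    η_mem_centre := fun _ => @continuous_of_const _ _ (_) (_) _ fun _ _ => rfl
    η_dense := fun x => @subset_closure _ (_) _ _ ⟨0, rfl⟩ }

/-- The trivial algebra `{0}`, an operator HLDBA over `A`. -/
def OpHLDBA.trivial [OperatorSpace A] : OpHLDBA.{u, v} A :=
  letI : OperatorSpace (HLDBA.trivial.{u, v} A).Carrier := zeroOperatorSpace
  letI : OperatorSpace (HLDBA.trivial.{u, v} A).Predual := zeroOperatorSpace
  { HLDBA.trivial.{u, v} A with
    opCarrier := zeroOperatorSpace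
    opPredual := zeroOperatorSpace
    mnorm_eq_dual := fun _ =>
      (dualMNorm_of_subsingleton (E := (HLDBA.trivial.{u, v} A).Predual)
        (inferInstanceAs (Subsingleton PUnit)) _).symm
    mul_cc := fun _ _ _ _ => (mul_zero (0 : ℝ)).ge
    η_cc := fun x => mnorm_nonneg x }

end Trivial

end

/-! Everything rests on density: weak*-continuous maps that agree on `η(A)` are equal. Hence a
comparison map is unique, is multiplicative without this being assumed (`HLDBA.IsHom.map_mul`), and
two opposite comparison maps are inverse isometries, so `≤` is antisymmetric on classes.

For suprema, the ℓ^∞-product is the dual of the ℓ¹-sum of the preduals (`lpDual`), and a bounded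
linear map into it is weak*-continuous as soon as its coordinates are (`weakStar_continuous_lp`).
Therefore right multiplications are weak*-continuous on the product and the diagonal image of `A`
lies in its topological centre. The weak*-closure of that image is an algebra; by Hahn–Banach
(`mem_weakStar_closure`) it is the annihilator of its preannihilator `N`, hence the dual of the
quotient by `N`, and its weak*-topology is the inherited one (`annihilatorDual`). The coordinates
show that it is an upper bound. The comparison maps from any other upper bound assemble to a
weak*-continuous map into the product that sends `η(A)` to the diagonal, hence takes its values in
the closure.

In the operator version the new predual needs matrix norms. Instead of an operator structure on the
ℓ¹-sum and its quotient, `IsDualMatrixNorm` asks that the matrix norms of `E` be recovered from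
those matrices over the predual that act completely contractively on `E`. This property passes to
ℓ^∞-products and to annihilators, and it makes `E` the operator dual of its predual once the latter
is given the structure of a subspace of `E*`.

The pre-adjoint of `η` embeds the predual of any HLDBA into `A*`. This bounds the size of the HLDBAs
over `A`, so that arbitrary suprema exist within one universe and the order is a complete lattice.
The adjoint of the same map goes from `A**` to the HLDBA and shows that `A**` is the maximum. That
`A**` is an operator HLDBA follows by reassociating threefold tensor indices in the definition of
the Arens product. -/

noncomputable section

open OperatorSpace

/-! ### Operator norms of scalar matrices -/

section ScalarOpNorm

variable {l m n m' n' : Type*} [Fintype l] [Fintype m] [Fintype n] [Fintype m'] [Fintype n']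
  [DecidableEq n] [DecidableEq n']

theorem scalarOpNorm_nonneg (α : Matrix m n ℂ) : 0 ≤ scalarOpNorm α := norm_nonneg _

theorem scalarOpNorm_zero : scalarOpNorm (0 : Matrix m n ℂ) = 0 := by
  simp [scalarOpNorm]

theorem scalarOpNorm_add_le (α β : Matrix m n ℂ) :
    scalarOpNorm (α + β) ≤ scalarOpNorm α + scalarOpNorm β := by
  unfold scalarOpNorm
  rw [map_add, map_add]
  exact norm_add_le _ _

theorem scalarOpNorm_smul (c : ℂ) (α : Matrix m n ℂ) :
    scalarOpNorm (c • α) = ‖c‖ * scalarOpNorm α := by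
  unfold scalarOpNorm
  rw [map_smul, map_smul, norm_smul]

theorem scalarOpNorm_sum_le {ι : Type*} (s : Finset ι) (α : ι → Matrix m n ℂ) :
    scalarOpNorm (∑ i ∈ s, α i) ≤ ∑ i ∈ s, scalarOpNorm (α i) := by
  unfold scalarOpNorm
  rw [map_sum, map_sum]
  exact norm_sum_le _ _

theorem scalarOpNorm_mul_le [DecidableEq m] (α : Matrix l m ℂ) (β : Matrix m n ℂ) :
    scalarOpNorm (α * β) ≤ scalarOpNorm α * scalarOpNorm β :=
  Matrix.l2_opNorm_mul α β

/-- Together with `scalarOpNorm_le_of_sum_norm_sq` this reduces norm estimates for scalar matrices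
to finite sums of squares. -/
theorem sum_norm_sq_le_scalarOpNorm (α : Matrix m n ℂ) (u : n → ℂ) :
    ∑ i, ‖∑ j, α i j * u j‖ ^ 2 ≤ scalarOpNorm α ^ 2 * ∑ j, ‖u j‖ ^ 2 := by
  have h := (Matrix.toEuclideanLin α).toContinuousLinearMap.le_opNorm (WithLp.toLp 2 u)
  have h2 := pow_le_pow_left₀ (norm_nonneg _) h 2
  rw [mul_pow, EuclideanSpace.norm_sq_eq, EuclideanSpace.norm_sq_eq] at h2
  exact h2

theorem scalarOpNorm_le_of_sum_norm_sq {α : Matrix m n ℂ} {C : ℝ} (hC : 0 ≤ C)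
    (h : ∀ u : n → ℂ, ∑ i, ‖∑ j, α i j * u j‖ ^ 2 ≤ C ^ 2 * ∑ j, ‖u j‖ ^ 2) :
    scalarOpNorm α ≤ C := by
  refine ContinuousLinearMap.opNorm_le_bound _ hC fun u => ?_
  refine le_of_sq_le_sq ?_ (by positivity)
  rw [mul_pow, EuclideanSpace.norm_sq_eq, EuclideanSpace.norm_sq_eq]
  exact h u

/-- A vector on `n'` extends by zero to `n` without change of norm; injectivity of `f` ensures that
no row is counted twice. -/
theorem scalarOpNorm_submatrix_le (α : Matrix m n ℂ) {f : m' → m} {g : n' → n}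
    (hf : Function.Injective f) (hg : Function.Injective g) :
    scalarOpNorm (α.submatrix f g) ≤ scalarOpNorm α := by
  refine scalarOpNorm_le_of_sum_norm_sq (scalarOpNorm_nonneg _) fun u => ?_
  have h1 : ∑ j, ‖Function.extend g u 0 j‖ ^ 2 = ∑ j, ‖u j‖ ^ 2 := by
    refine (Fintype.sum_of_injective g hg _ _ (fun j hj => ?_) fun j => ?_).symm
    · rw [Function.extend_apply' _ _ _ (by simpa using hj)]
      simp
    · rw [hg.extend_apply]
  have h2 : ∀ i, ∑ j, α i j * Function.extend g u 0 j = ∑ j, α i (g j) * u j := by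
    intro i
    refine (Fintype.sum_of_injective g hg _ _ (fun j hj => ?_) fun j => ?_).symm
    · rw [Function.extend_apply' _ _ _ (by simpa using hj)]
      simp
    · rw [hg.extend_apply]
  have h := sum_norm_sq_le_scalarOpNorm α (Function.extend g u 0)
  simp only [h1, h2] at h
  refine le_trans ?_ h
  classical
  simp only [Matrix.submatrix_apply]
  rw [← Finset.sum_image (s := Finset.univ) (g := f)
    (f := fun i => ‖∑ j, α i (g j) * u j‖ ^ 2) (fun _ _ _ _ h => hf h)]
  exact Finset.sum_le_univ_sum_of_nonneg fun _ => by positivity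

theorem scalarOpNorm_submatrix_equiv (α : Matrix m n ℂ) (f : m' ≃ m) (g : n' ≃ n) :
    scalarOpNorm (α.submatrix f g) = scalarOpNorm α := by
  refine le_antisymm (scalarOpNorm_submatrix_le α f.injective g.injective) ?_
  have := scalarOpNorm_submatrix_le (α.submatrix f g) f.symm.injective g.symm.injective
  simpa using this

theorem norm_entry_le_scalarOpNorm (α : Matrix m n ℂ) (i : m) (j : n) :
    ‖α i j‖ ≤ scalarOpNorm α := by
  -- A basis vector is mapped to the `j`-th column, whose norm dominates each of its entries.
  have h := sum_norm_sq_le_scalarOpNorm α (Pi.single j 1)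
  have h1 : ∑ k, ‖(Pi.single j 1 : n → ℂ) k‖ ^ 2 = 1 := by
    rw [Finset.sum_eq_single j] <;> simp +contextual
  have h2 : ‖α i j‖ ^ 2 ≤ ∑ i, ‖α i j‖ ^ 2 :=
    Finset.single_le_sum (f := fun i => ‖α i j‖ ^ 2) (fun _ _ => by positivity) (Finset.mem_univ i)
  simp only [Pi.single_apply, mul_ite, mul_one, mul_zero, Finset.sum_ite_eq', Finset.mem_univ,
    if_true] at h
  refine le_of_sq_le_sq ?_ (scalarOpNorm_nonneg _)
  simp only [Pi.single_apply] at h1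
  rw [h1] at h
  linarith

theorem scalarOpNorm_fromBlocks_le (α : Matrix m n ℂ) (β : Matrix m' n' ℂ) :
    scalarOpNorm (Matrix.fromBlocks α 0 0 β) ≤ max (scalarOpNorm α) (scalarOpNorm β) := by
  refine scalarOpNorm_le_of_sum_norm_sq (le_max_of_le_left (scalarOpNorm_nonneg _)) fun u => ?_
  simp only [Fintype.sum_sum_type, Matrix.fromBlocks_apply₁₁, Matrix.fromBlocks_apply₁₂,
    Matrix.fromBlocks_apply₂₁, Matrix.fromBlocks_apply₂₂, Matrix.zero_apply, zero_mul,
    Finset.sum_const_zero, add_zero, zero_add, mul_add]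
  refine add_le_add ((sum_norm_sq_le_scalarOpNorm α _).trans ?_)
    ((sum_norm_sq_le_scalarOpNorm β _).trans ?_)
  · have := scalarOpNorm_nonneg α
    gcongr
    exact le_max_left _ _
  · have := scalarOpNorm_nonneg β
    gcongr
    exact le_max_right _ _

/-- Amplification of `α` by an identity matrix does not increase the norm. -/
theorem scalarOpNorm_amplify_le [DecidableEq l] (α : Matrix m n ℂ) :
    scalarOpNorm (Matrix.of fun (p : m × l) (q : n × l) => if p.2 = q.2 then α p.1 q.1 else 0)
      ≤ scalarOpNorm α := by
  refine scalarOpNorm_le_of_sum_norm_sq (scalarOpNorm_nonneg _) fun u => ?_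
  simp only [Fintype.sum_prod_type, Matrix.of_apply, ite_mul, zero_mul, Finset.sum_ite_eq,
    Finset.mem_univ, if_true]
  rw [Finset.sum_comm, Finset.sum_comm (f := fun x y => ‖u (x, y)‖ ^ 2), Finset.mul_sum]
  exact Finset.sum_le_sum fun p _ => sum_norm_sq_le_scalarOpNorm α fun k => u (k, p)

/-- Placing `α` as a single block of a block matrix does not increase the norm. -/
theorem scalarOpNorm_block_le [DecidableEq m'] (α : Matrix m n ℂ) (k : m') (l : n') :
    scalarOpNorm (Matrix.of fun (p : m' × m) (q : n' × n) =>
      if p.1 = k ∧ q.1 = l then α p.2 q.2 else 0) ≤ scalarOpNorm α := by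
  refine scalarOpNorm_le_of_sum_norm_sq (scalarOpNorm_nonneg _) fun u => ?_
  have h1 : ∀ (i : m') (p : m), ∑ q : n' × n,
      (if i = k ∧ q.1 = l then α p q.2 else 0) * u q
        = if i = k then ∑ j, α p j * u (l, j) else 0 := by
    intro i p
    rw [Fintype.sum_prod_type, Finset.sum_eq_single l]
    · split_ifs with h <;> simp [h]
    · intro j _ hj
      simp [hj]
    · simp
  have h2 := sum_norm_sq_le_scalarOpNorm α fun j => u (l, j)
  have h3 : ∑ j, ‖u (l, j)‖ ^ 2 ≤ ∑ q : n' × n, ‖u q‖ ^ 2 := by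
    rw [Fintype.sum_prod_type]
    exact Finset.single_le_sum (f := fun i => ∑ j, ‖u (i, j)‖ ^ 2)
      (fun _ _ => Finset.sum_nonneg fun _ _ => by positivity) (Finset.mem_univ l)
  refine le_trans (le_of_eq ?_) (h2.trans (mul_le_mul_of_nonneg_left h3 (sq_nonneg _)))
  simp only [Matrix.of_apply]
  rw [Fintype.sum_prod_type]
  simp only [h1]
  rw [Finset.sum_eq_single k]
  · simp
  · intro i _ hi
    simp [hi]
  · simp

/-- The norm of a row matrix. -/
theorem scalarOpNorm_row_le (u : n → ℂ) {C : ℝ} (hC : 0 ≤ C) (h : ∑ j, ‖u j‖ ^ 2 ≤ C ^ 2) :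
    scalarOpNorm (Matrix.of fun (_ : Fin 1) j => u j) ≤ C := by
  refine scalarOpNorm_le_of_sum_norm_sq hC fun v => ?_
  simp only [Finset.univ_unique, Finset.sum_singleton, Matrix.of_apply]
  refine le_trans ?_ (mul_le_mul_of_nonneg_right h (Finset.sum_nonneg fun _ _ => by positivity))
  refine le_trans ?_ (Finset.sum_mul_sq_le_sq_mul_sq _ _ _)
  gcongr
  exact (norm_sum_le _ _).trans_eq (by simp)

/-- The norm of a column matrix. -/
theorem scalarOpNorm_col_le (u : m → ℂ) {C : ℝ} (hC : 0 ≤ C) (h : ∑ j, ‖u j‖ ^ 2 ≤ C ^ 2) :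
    scalarOpNorm (Matrix.of fun j (_ : Fin 1) => u j) ≤ C := by
  refine scalarOpNorm_le_of_sum_norm_sq hC fun v => ?_
  simp only [Finset.univ_unique, Finset.sum_singleton, Matrix.of_apply, norm_mul, mul_pow]
  rw [← Finset.sum_mul]
  gcongr

end ScalarOpNorm

/-! ### Matrix norms and the dual operator space -/

section MatrixNorm

variable {E F : Type*} [NormedAddCommGroup E] [NormedSpace ℂ E] [OperatorSpace E]
  [NormedAddCommGroup F] [NormedSpace ℂ F]

theorem mnorm_zero {n : ℕ} : mnorm (0 : Matrix (Fin n) (Fin n) E) = 0 := by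
  simpa using mnorm_smul (0 : ℂ) (0 : Matrix (Fin n) (Fin n) E)

theorem mnorm_sum_le {ι : Type*} {n : ℕ} (s : Finset ι) (x : ι → Matrix (Fin n) (Fin n) E) :
    mnorm (∑ i ∈ s, x i) ≤ ∑ i ∈ s, mnorm (x i) :=
  Finset.le_sum_of_subadditive _ mnorm_zero.le mnorm_add_le _ _

/-- A matrix with one nonzero entry is a unit column times a `1 × 1` matrix times a unit row, so
Ruan's axiom bounds it. The crude estimate serves to show that suprema of matrix norms are finite.
-/
theorem mnorm_le_sum_norm {n : ℕ} (x : Matrix (Fin n) (Fin n) E) :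
    mnorm x ≤ ∑ k, ∑ l, ‖x k l‖ := by
  have hx : x = ∑ k, ∑ l, Matrix.single k l (x k l) := Matrix.matrix_eq_sum_single x
  conv_lhs => rw [hx]
  refine (mnorm_sum_le _ _).trans (Finset.sum_le_sum fun k _ => ?_)
  refine (mnorm_sum_le _ _).trans (Finset.sum_le_sum fun l _ => ?_)
  have hu : ∀ k : Fin n, ∑ j, ‖(Pi.single k 1 : Fin n → ℂ) j‖ ^ 2 ≤ (1 : ℝ) ^ 2 := by
    intro k
    rw [Finset.sum_eq_single k] <;> simp +contextual
  have hc := scalarOpNorm_col_le (Pi.single k 1) zero_le_one (hu k)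
  have hr := scalarOpNorm_row_le (Pi.single l 1) zero_le_one (hu l)
  have h := mnorm_mul_le (Matrix.of fun j (_ : Fin 1) => (Pi.single k 1 : Fin n → ℂ) j)
    (Matrix.of fun _ _ => x k l) (Matrix.of fun (_ : Fin 1) j => (Pi.single l 1 : Fin n → ℂ) j)
  rw [mnorm_one] at h
  have he : (Matrix.of fun i j => ∑ k', ∑ l',
      ((Matrix.of fun j (_ : Fin 1) => (Pi.single k 1 : Fin n → ℂ) j) i k' *
        (Matrix.of fun (_ : Fin 1) j => (Pi.single l 1 : Fin n → ℂ) j) l' j) •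
        (Matrix.of fun (_ _ : Fin 1) => x k l) k' l') = Matrix.single k l (x k l) := by
    ext i j
    simp only [Finset.univ_unique, Finset.sum_singleton, Matrix.of_apply, Matrix.single_apply,
      Pi.single_apply, @eq_comm _ i k, @eq_comm _ j l]
    by_cases h1 : k = i <;> by_cases h2 : l = j <;> simp [h1, h2]
  rw [he] at h
  refine h.trans ?_
  have h1 : scalarOpNorm (Matrix.of fun j (_ : Fin 1) => (Pi.single k 1 : Fin n → ℂ) j) * ‖x k l‖
      ≤ 1 * ‖x k l‖ := by gcongr
  have := mul_le_mul h1 hr (scalarOpNorm_nonneg _) (by positivity)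
  simpa using this

/-- Bounded functionals are completely bounded, with the same norm. -/
theorem scalarOpNorm_map_le (f : StrongDual ℂ E) {m : ℕ} (x : Matrix (Fin m) (Fin m) E) :
    scalarOpNorm (Matrix.of fun p q => f (x p q)) ≤ ‖f‖ * mnorm x := by
  have hC : 0 ≤ ‖f‖ * mnorm x := mul_nonneg (norm_nonneg _) (mnorm_nonneg _)
  refine scalarOpNorm_le_of_sum_norm_sq hC fun u => ?_
  -- With `w = f(x) u`, the scalar `w* f(x) u` is `‖w‖²`, and it is also the value of `f` at the
  -- single vector `w* x u` of `E`. Ruan's axiom bounds that vector, so the norm of `f` on `E`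
  -- suffices: `‖w‖² ≤ ‖f‖ ‖w‖ ‖x‖ ‖u‖`.
  set w : Fin m → ℂ := fun i => ∑ j, f (x i j) * u j with hw
  set a : ℝ := √(∑ i, ‖w i‖ ^ 2) with ha
  set b : ℝ := √(∑ i, ‖u i‖ ^ 2) with hb
  have ha2 : a ^ 2 = ∑ i, ‖w i‖ ^ 2 := Real.sq_sqrt (by positivity)
  have hb2 : b ^ 2 = ∑ i, ‖u i‖ ^ 2 := Real.sq_sqrt (by positivity)
  have ha0 : 0 ≤ a := Real.sqrt_nonneg _
  have hb0 : 0 ≤ b := Real.sqrt_nonneg _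
  have hr : scalarOpNorm (Matrix.of fun (_ : Fin 1) j => star (w j)) ≤ a :=
    scalarOpNorm_row_le _ ha0 (by simp [ha2])
  have hc : scalarOpNorm (Matrix.of fun j (_ : Fin 1) => u j) ≤ b :=
    scalarOpNorm_col_le _ hb0 (by simp [hb2])
  have h := mnorm_mul_le (Matrix.of fun (_ : Fin 1) j => star (w j)) x
    (Matrix.of fun j (_ : Fin 1) => u j)
  have he := mnorm_one (∑ k, ∑ l, (star (w k) * u l) • x k l)
  have h' : ‖∑ k, ∑ l, (star (w k) * u l) • x k l‖ ≤ a * mnorm x * b := by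
    rw [← he]
    refine h.trans ?_
    have := mnorm_nonneg x
    have := scalarOpNorm_nonneg (Matrix.of fun j (_ : Fin 1) => u j)
    gcongr
  have hf : f (∑ k, ∑ l, (star (w k) * u l) • x k l) = (a ^ 2 : ℝ) := by
    rw [ha2]
    push_cast
    simp only [map_sum, map_smul]
    refine Finset.sum_congr rfl fun k _ => ?_
    rw [← Complex.conj_mul', hw]
    simp only [Finset.mul_sum, smul_eq_mul]
    refine Finset.sum_congr rfl fun l _ => ?_
    simp only [starRingEnd_apply]
    ring
  have h3 : a ^ 2 ≤ ‖f‖ * (a * mnorm x * b) := by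
    have := (f.le_opNorm _).trans (mul_le_mul_of_nonneg_left h' (norm_nonneg f))
    rw [hf, Complex.norm_real, Real.norm_of_nonneg (by positivity)] at this
    exact this
  change ∑ i, ‖w i‖ ^ 2 ≤ _
  rw [← hb2, ← ha2, ← mul_pow]
  refine pow_le_pow_left₀ ha0 ?_ 2
  rcases ha0.eq_or_lt with h0 | h0
  · rw [← h0]
    positivity
  · refine le_of_mul_le_mul_left ?_ h0
    linarith

/-- A real `sSup` of an unbounded set is `0`, so `dualMNorm` has its meaning only through this
bound. The pairing matrix is the sum of its `n²` blocks, and each block is controlled because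
functionals are completely bounded. -/
theorem dualMNorm_bddAbove {n : ℕ} (f : Matrix (Fin n) (Fin n) (StrongDual ℂ E)) :
    BddAbove {r : ℝ | ∃ (m : ℕ) (x : Matrix (Fin m) (Fin m) E), mnorm x ≤ 1 ∧
    r = scalarOpNorm (Matrix.of fun p q : Fin n × Fin m => f p.1 q.1 (x p.2 q.2))} := by
  refine ⟨∑ k, ∑ l, ‖f k l‖, ?_⟩
  rintro _ ⟨m, x, hx, rfl⟩
  have he : (Matrix.of fun p q : Fin n × Fin m => f p.1 q.1 (x p.2 q.2))
      = ∑ k, ∑ l, Matrix.of fun (p q : Fin n × Fin m) => if p.1 = k ∧ q.1 = l then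
        (Matrix.of fun i j => f k l (x i j)) p.2 q.2 else 0 := by
    ext p q
    simp only [Matrix.sum_apply, Matrix.of_apply]
    rw [Finset.sum_eq_single p.1, Finset.sum_eq_single q.1] <;> simp +contextual [eq_comm]
  rw [he]
  refine (scalarOpNorm_sum_le _ _).trans (Finset.sum_le_sum fun k _ => ?_)
  refine (scalarOpNorm_sum_le _ _).trans (Finset.sum_le_sum fun l _ => ?_)
  refine (scalarOpNorm_block_le _ k l).trans ((scalarOpNorm_map_le _ _).trans ?_)
  exact mul_le_of_le_one_right (norm_nonneg _) hx

theorem dualMNorm_nonneg {n : ℕ} (f : Matrix (Fin n) (Fin n) (StrongDual ℂ E)) :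
    0 ≤ dualMNorm f := by
  refine Real.sSup_nonneg ?_
  rintro _ ⟨m, x, -, rfl⟩
  exact scalarOpNorm_nonneg _

theorem dualMNorm_le {n : ℕ} {f : Matrix (Fin n) (Fin n) (StrongDual ℂ E)} {C : ℝ} (hC : 0 ≤ C)
    (h : ∀ (m : ℕ) (x : Matrix (Fin m) (Fin m) E), mnorm x ≤ 1 →
      scalarOpNorm (Matrix.of fun p q : Fin n × Fin m => f p.1 q.1 (x p.2 q.2)) ≤ C) :
    dualMNorm f ≤ C := by
  refine Real.sSup_le ?_ hC
  rintro _ ⟨m, x, hx, rfl⟩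
  exact h m x hx

theorem scalarOpNorm_pairing_le {n m : ℕ} (f : Matrix (Fin n) (Fin n) (StrongDual ℂ E))
    (x : Matrix (Fin m) (Fin m) E) :
    scalarOpNorm (Matrix.of fun p q : Fin n × Fin m => f p.1 q.1 (x p.2 q.2))
      ≤ dualMNorm f * mnorm x := by
  rcases (mnorm_nonneg x).eq_or_lt with h0 | h0
  · rw [eq_zero_of_mnorm_eq_zero x h0.symm]
    have : (Matrix.of fun p q : Fin n × Fin m =>
        f p.1 q.1 ((0 : Matrix (Fin m) (Fin m) E) p.2 q.2)) = 0 := by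
      ext
      simp
    rw [this, scalarOpNorm_zero, mnorm_zero, mul_zero]
  · have hx : mnorm (((mnorm x)⁻¹ : ℂ) • x) ≤ 1 := by
      rw [mnorm_smul, norm_inv, Complex.norm_real, Real.norm_of_nonneg h0.le,
        inv_mul_cancel₀ h0.ne']
    have h := le_csSup (dualMNorm_bddAbove f) ⟨m, _, hx, rfl⟩
    have he : (Matrix.of fun p q : Fin n × Fin m =>
        f p.1 q.1 ((((mnorm x)⁻¹ : ℂ) • x) p.2 q.2)) =
        ((mnorm x)⁻¹ : ℂ) • (Matrix.of fun p q : Fin n × Fin m => f p.1 q.1 (x p.2 q.2)) := by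
      ext
      simp
    rw [he, scalarOpNorm_smul, norm_inv, Complex.norm_real, Real.norm_of_nonneg h0.le,
      inv_mul_le_iff₀ h0, mul_comm] at h
    exact h

theorem scalarOpNorm_pairing_le_of_le_one {n m : ℕ}
    (f : Matrix (Fin n) (Fin n) (StrongDual ℂ E)) {x : Matrix (Fin m) (Fin m) E}
    (hx : mnorm x ≤ 1) :
    scalarOpNorm (Matrix.of fun p q : Fin n × Fin m => f p.1 q.1 (x p.2 q.2)) ≤ dualMNorm f :=
  (scalarOpNorm_pairing_le f x).trans (mul_le_of_le_one_right (dualMNorm_nonneg f) hx)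

variable (E) in
/-- The dual operator space. -/
@[reducible] def dualOperatorSpace : OperatorSpace (StrongDual ℂ E) where
  mnorm := dualMNorm
  mnorm_one f := by
    refine le_antisymm (dualMNorm_le (norm_nonneg _) fun m x hx => ?_) ?_
    · have h := scalarOpNorm_map_le f x
      refine le_trans ?_ (h.trans (mul_le_of_le_one_right (norm_nonneg _) hx))
      exact scalarOpNorm_submatrix_le (Matrix.of fun p q => f (x p q))
        (f := fun p : Fin 1 × Fin m => p.2) (g := fun p : Fin 1 × Fin m => p.2)
        (fun p q h => Prod.ext (Subsingleton.elim _ _) h)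
        (fun p q h => Prod.ext (Subsingleton.elim _ _) h)
    · refine f.opNorm_le_bound (dualMNorm_nonneg _) fun x => ?_
      have h := scalarOpNorm_pairing_le (n := 1) (m := 1) (Matrix.of fun _ _ => f)
        (Matrix.of fun _ _ => x)
      rw [mnorm_one] at h
      exact (norm_entry_le_scalarOpNorm _ (0, 0) (0, 0)).trans h
  mnorm_add_le f g := by
    refine dualMNorm_le (add_nonneg (dualMNorm_nonneg _) (dualMNorm_nonneg _)) fun m x hx => ?_
    exact (scalarOpNorm_add_le _ _).trans (add_le_add (scalarOpNorm_pairing_le_of_le_one f hx)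
      (scalarOpNorm_pairing_le_of_le_one g hx))
  mnorm_smul c f := by
    have hle : ∀ (c : ℂ) {n : ℕ} (f : Matrix (Fin n) (Fin n) (StrongDual ℂ E)),
        dualMNorm (c • f) ≤ ‖c‖ * dualMNorm f := fun c n f => by
      refine dualMNorm_le (mul_nonneg (norm_nonneg _) (dualMNorm_nonneg _)) fun m x hx => ?_
      exact (scalarOpNorm_smul c _).trans_le (mul_le_mul_of_nonneg_left
        (scalarOpNorm_pairing_le_of_le_one f hx) (norm_nonneg _))
    refine le_antisymm (hle c f) ?_
    rcases eq_or_ne c 0 with rfl | hc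
    · simpa using dualMNorm_nonneg _
    · have h := hle c⁻¹ (c • f)
      rw [smul_smul, inv_mul_cancel₀ hc, one_smul, norm_inv] at h
      rwa [le_inv_mul_iff₀ (norm_pos_iff.2 hc)] at h
  eq_zero_of_mnorm_eq_zero f hf := by
    ext i j x
    have h := scalarOpNorm_pairing_le (m := 1) f (Matrix.of fun _ _ => x)
    rw [hf, zero_mul] at h
    have := (norm_entry_le_scalarOpNorm _ (i, 0) (j, 0)).trans h
    simpa using this
  mnorm_directSum {n n'} f g := by
    refine le_antisymm (dualMNorm_le (le_max_of_le_left (dualMNorm_nonneg _)) fun m x hx => ?_)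
      (max_le ?_ ?_)
    · refine le_trans ?_ (max_le_max (scalarOpNorm_pairing_le_of_le_one f hx)
        (scalarOpNorm_pairing_le_of_le_one g hx))
      refine le_trans (le_of_eq ?_) (scalarOpNorm_fromBlocks_le _ _)
      -- Distributing the product of index sets over `n + n'` makes the pairing matrix block
      -- diagonal.
      rw [← scalarOpNorm_submatrix_equiv (Matrix.fromBlocks _ _ _ _)
        ((finSumFinEquiv.symm.prodCongr (Equiv.refl _)).trans (Equiv.sumProdDistrib _ _ _))
        ((finSumFinEquiv.symm.prodCongr (Equiv.refl _)).trans (Equiv.sumProdDistrib _ _ _))]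
      congr 1
      ext ⟨p, p'⟩ ⟨q, q'⟩
      obtain ⟨p, rfl⟩ := finSumFinEquiv.surjective p
      obtain ⟨q, rfl⟩ := finSumFinEquiv.surjective q
      rcases p with p | p <;> rcases q with q | q <;> simp
    · refine dualMNorm_le (dualMNorm_nonneg _) fun m x hx => ?_
      refine le_trans (le_of_eq_of_le ?_ (scalarOpNorm_submatrix_le _
        (f := fun p : Fin n × Fin m => ((finSumFinEquiv (Sum.inl p.1) : Fin (n + n')), p.2))
        (g := fun p : Fin n × Fin m => ((finSumFinEquiv (Sum.inl p.1) : Fin (n + n')), p.2))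
        ?_ ?_)) (scalarOpNorm_pairing_le_of_le_one _ hx)
      · congr 1
        ext p q
        simp
      all_goals
      · rintro ⟨p, p'⟩ ⟨q, q'⟩ h
        simpa using h
    · refine dualMNorm_le (dualMNorm_nonneg _) fun m x hx => ?_
      refine le_trans (le_of_eq_of_le ?_ (scalarOpNorm_submatrix_le _
        (f := fun p : Fin n' × Fin m => ((finSumFinEquiv (Sum.inr p.1) : Fin (n + n')), p.2))
        (g := fun p : Fin n' × Fin m => ((finSumFinEquiv (Sum.inr p.1) : Fin (n + n')), p.2))
        ?_ ?_)) (scalarOpNorm_pairing_le_of_le_one _ hx)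
      · congr 1
        ext p q
        simp
      all_goals
      · rintro ⟨p, p'⟩ ⟨q, q'⟩ h
        simpa using h
  mnorm_mul_le {m n} α f β := by
    refine dualMNorm_le (mul_nonneg (mul_nonneg (scalarOpNorm_nonneg _) (dualMNorm_nonneg _))
      (scalarOpNorm_nonneg _)) fun k x hx => ?_
    -- The pairing of `α f β` with `x` factors as `(α ⊗ 1) [f(x)] (β ⊗ 1)`.
    have he : (Matrix.of fun p q : Fin n × Fin k =>
        (Matrix.of fun i j => ∑ k, ∑ l, (α i k * β l j) • f k l) p.1 q.1 (x p.2 q.2)) =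
        (Matrix.of fun (p : Fin n × Fin k) (q : Fin m × Fin k) =>
          if p.2 = q.2 then α p.1 q.1 else 0) *
        (Matrix.of fun p q : Fin m × Fin k => f p.1 q.1 (x p.2 q.2)) *
        (Matrix.of fun (p : Fin m × Fin k) (q : Fin n × Fin k) =>
          if p.2 = q.2 then β p.1 q.1 else 0) := by
      ext p q
      simp only [Matrix.of_apply, Matrix.mul_apply, Fintype.sum_prod_type, ite_mul, zero_mul,
        mul_ite, mul_zero, Finset.sum_ite_eq, Finset.sum_ite_eq', Finset.mem_univ, if_true,
        sum_apply, smul_apply, smul_eq_mul]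
      rw [Finset.sum_comm]
      refine Finset.sum_congr rfl fun j _ => ?_
      rw [Finset.sum_mul]
      exact Finset.sum_congr rfl fun i _ => by ring
    rw [he]
    refine (scalarOpNorm_mul_le _ _).trans (mul_le_mul ((scalarOpNorm_mul_le _ _).trans
      (mul_le_mul (scalarOpNorm_amplify_le α) (scalarOpNorm_pairing_le_of_le_one f hx)
        (scalarOpNorm_nonneg _) (scalarOpNorm_nonneg _))) (scalarOpNorm_amplify_le β)
      (scalarOpNorm_nonneg _) (mul_nonneg (scalarOpNorm_nonneg _) (dualMNorm_nonneg _)))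

/-- The operator space structure that `F` inherits from `E` through a linear isometry. -/
@[reducible] def OperatorSpace.comap (j : F →ₗᵢ[ℂ] E) : OperatorSpace F where
  mnorm x := mnorm (x.map j)
  mnorm_one x := (mnorm_one (j x)).trans (j.norm_map x)
  mnorm_add_le x y := by
    rw [Matrix.map_add j (map_add j)]
    exact mnorm_add_le _ _
  mnorm_smul c x := by
    rw [← mnorm_smul]
    congr 1
    ext
    simp
  eq_zero_of_mnorm_eq_zero x hx := by
    have h := eq_zero_of_mnorm_eq_zero _ hx
    ext i k
    exact j.injective ((congrFun (congrFun h i) k).trans (map_zero j).symm)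
  mnorm_directSum x y := by
    rw [← mnorm_directSum]
    congr 1
    ext p q
    obtain ⟨p, rfl⟩ := finSumFinEquiv.surjective p
    obtain ⟨q, rfl⟩ := finSumFinEquiv.surjective q
    rcases p with p | p <;> rcases q with q | q <;> simp
  mnorm_mul_le α x β := by
    refine le_of_eq_of_le ?_ (mnorm_mul_le α (x.map j) β)
    congr 1
    ext
    simp

end MatrixNorm

/-! ### Weak-star continuity -/

section WeakStarLemmas

variable {E V F W : Type*} [NormedAddCommGroup E] [NormedSpace ℂ E]
  [NormedAddCommGroup V] [NormedSpace ℂ V] [NormedAddCommGroup F] [NormedSpace ℂ F]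
  [NormedAddCommGroup W] [NormedSpace ℂ W]

/-- As an initial topology for evaluations, the weak*-topology can be compared with another one by
reindexing along a surjection between the preduals. -/
theorem weakStar_eq_induced (d : E ≃ₗᵢ[ℂ] StrongDual ℂ V) :
    weakStar d = TopologicalSpace.induced (fun μ (v : V) => d μ v) Pi.topologicalSpace := by
  have : (inferInstance : TopologicalSpace (WeakDual ℂ V)) =
      TopologicalSpace.induced (fun (x : WeakDual ℂ V) (v : V) => x v) Pi.topologicalSpace := rfl
  rw [weakStar, this, induced_compose]
  rfl

theorem weakStar_t2 (d : E ≃ₗᵢ[ℂ] StrongDual ℂ V) : @T2Space E (weakStar d) := by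
  let := weakStar d
  refine T2Space.of_injective_continuous (f := fun μ => StrongDual.toWeakDual (d μ)) ?_
    continuous_induced_dom
  exact (StrongDual.toWeakDual (𝕜 := ℂ) (E := V)).injective.comp d.injective

theorem weakStar_continuous_iff (d : E ≃ₗᵢ[ℂ] StrongDual ℂ V) (d' : F ≃ₗᵢ[ℂ] StrongDual ℂ W)
    (f : E → F) : Continuous[weakStar d, weakStar d'] f ↔
      ∀ w, Continuous[weakStar d, inferInstance] fun μ => d' (f μ) w := by
  let := weakStar d
  refine ⟨fun h w => ?_, fun h => weakStar_continuous_of_eval d' f h⟩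
  let := weakStar d'
  exact (weakStar_eval d' w).comp h

/-- Weak-star continuous maps that agree on a weak-star dense set are equal. -/
theorem weakStar_ext {d : E ≃ₗᵢ[ℂ] StrongDual ℂ V} {d' : F ≃ₗᵢ[ℂ] StrongDual ℂ W} {f g : E → F}
    (hf : Continuous[weakStar d, weakStar d'] f) (hg : Continuous[weakStar d, weakStar d'] g)
    {s : Set E} (hs : @Dense E (weakStar d) s) (h : ∀ x ∈ s, f x = g x) : f = g := by
  let := weakStar d
  let := weakStar d'
  have := weakStar_t2 d'
  exact Continuous.ext_on hs hf hg h

theorem weakStar_comp {G U : Type*} [NormedAddCommGroup G] [NormedSpace ℂ G]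
    [NormedAddCommGroup U] [NormedSpace ℂ U]
    {d : E ≃ₗᵢ[ℂ] StrongDual ℂ V} {d' : F ≃ₗᵢ[ℂ] StrongDual ℂ W} {d'' : G ≃ₗᵢ[ℂ] StrongDual ℂ U}
    {g : F → G} {f : E → F} (hg : Continuous[weakStar d', weakStar d''] g)
    (hf : Continuous[weakStar d, weakStar d'] f) :
    Continuous[weakStar d, weakStar d''] fun x => g (f x) := by
  let := weakStar d
  let := weakStar d'
  let := weakStar d''
  exact hg.comp hf

/-- A point that is annihilated by every predual element that annihilates a subspace lies in the
weak-star closure of that subspace. -/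
theorem mem_weakStar_closure (d : E ≃ₗᵢ[ℂ] StrongDual ℂ V) (S : Submodule ℂ E) (μ : E)
    (h : ∀ v, (∀ ν ∈ S, d ν v = 0) → d μ v = 0) : μ ∈ @closure E (weakStar d) S := by
  let L : E →ₗ[ℂ] WeakDual ℂ V :=
    (StrongDual.toWeakDual (𝕜 := ℂ) (E := V)).toLinearMap ∘ₗ d.toLinearEquiv.toLinearMap
  let t := weakStar d
  have : @IsTopologicalAddGroup E t _ := topologicalAddGroup_induced L
  have : @ContinuousSMul ℂ E _ _ t := continuousSMul_induced L
  have : @ContinuousSMul ℝ E _ _ t := IsScalarTower.continuousSMul ℂ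
  -- Local convexity concerns real scalars, so it is pulled back along the underlying real-linear
  -- map.
  let Lr : E →ₗ[ℝ] WeakDual ℂ V :=
    { L with map_smul' := fun c x => (map_smul L (c : ℂ) x).trans (Complex.coe_smul c (d x)) }
  have : @LocallyConvexSpace ℝ E _ _ _ _ t :=
    (WeakBilin.locallyConvexSpace (B := topDualPairing ℂ V)).induced Lr
  by_contra hμ
  obtain ⟨f, u, hu, hμu⟩ := RCLike.geometric_hahn_banach_closed_point (𝕜 := ℂ) (E := E)
    (S.restrictScalars ℝ).convex.closure isClosed_closure hμ
  obtain ⟨v, hv⟩ := weakStar_functional d f.toLinearMap f.continuous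
  have hu0 : 0 < u := by simpa using hu 0 (subset_closure S.zero_mem)
  -- The real part of `f` stays below `u` on the subspace, so it vanishes there: a vector with
  -- negative value could be scaled to have the value `u` exactly, and `-ν` excludes positive
  -- values.
  have hre : ∀ ν ∈ S, 0 ≤ RCLike.re (f ν) := by
    intro ν hν
    by_contra! hneg
    have h1 := hu (((u / RCLike.re (f ν) : ℝ) : ℂ) • ν) (subset_closure (S.smul_mem _ hν))
    rw [map_smul, smul_eq_mul, RCLike.re_to_complex, Complex.re_ofReal_mul,
      ← RCLike.re_to_complex, div_mul_cancel₀ _ hneg.ne] at h1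
    exact h1.false
  have hre0 : ∀ ν ∈ S, RCLike.re (f ν) = 0 := by
    intro ν hν
    have h1 := hre _ (S.neg_mem hν)
    rw [map_neg, map_neg] at h1
    linarith [hre ν hν]
  have h0 : d μ v = 0 := by
    refine h v fun ν hν => ?_
    rw [← hv]
    -- The imaginary part at `ν` is, up to sign, the real part at `I • ν`.
    have h1 := hre0 _ (S.smul_mem Complex.I hν)
    have h2 := hre0 _ hν
    refine Complex.ext h2 ?_
    simpa using h1
  have h1 : f μ = 0 := (hv μ).trans h0
  rw [h1, map_zero] at hμu
  exact hμu.not_gt hu0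

end WeakStarLemmas

/-! ### Homomorphisms of HLDBAs -/

section Hom

variable {A : Type u} [NonUnitalNormedRing A] [NormedSpace ℂ A]

/-- Density is used twice, and the order matters. For `μ = η(a)` the identity extends to all `ν`
because `η(a)` is in the topological centre; it then extends to all `μ` because right
multiplications are weak*-continuous. The other order would need left multiplication by arbitrary
elements to be continuous. -/
theorem HLDBA.IsHom.map_mul {𝔄 : HLDBA.{u, v} A} {𝔅 : HLDBA.{u, w} A}
    {Φ : 𝔄.Carrier →ₗ[ℂ] 𝔅.Carrier} (h : 𝔄.IsHom 𝔅 Φ) (μ ν : 𝔄.Carrier) :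
    Φ (μ * ν) = Φ μ * Φ ν := by
  have h1 : ∀ a ν, Φ (𝔄.η a * ν) = 𝔅.η a * Φ ν := fun a ν =>
    congrFun (weakStar_ext (weakStar_comp h.weakStar (𝔄.η_mem_centre a))
      (weakStar_comp (𝔅.η_mem_centre a) h.weakStar) 𝔄.η_dense
      (by rintro _ ⟨b, rfl⟩; rw [← _root_.map_mul, h.comp_η, h.comp_η, _root_.map_mul])) ν
  exact congrFun (weakStar_ext (weakStar_comp h.weakStar (𝔄.mul_weakStar ν))
    (weakStar_comp (𝔅.mul_weakStar (Φ ν)) h.weakStar) 𝔄.η_dense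
    (by rintro _ ⟨a, rfl⟩; rw [h1, h.comp_η])) μ

theorem HLDBA.IsHom.eq_id {𝔄 : HLDBA.{u, v} A} {Φ : 𝔄.Carrier →ₗ[ℂ] 𝔄.Carrier}
    (h : 𝔄.IsHom 𝔄 Φ) (μ : 𝔄.Carrier) : Φ μ = μ :=
  congrFun (weakStar_ext (g := id) h.weakStar (@continuous_id _ (_root_.weakStar 𝔄.dual)) 𝔄.η_dense
    (by rintro _ ⟨a, rfl⟩; exact h.comp_η a)) μ

/-- Both composites fix the dense image of `A`, so they are identities, and mutually inverse
contractions are isometries. -/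
theorem HLDBA.Le.antisymm {𝔄 𝔅 : HLDBA.{u, v} A} (h : 𝔄.Le 𝔅) (h' : 𝔅.Le 𝔄) : 𝔄.Equiv 𝔅 := by
  obtain ⟨Φ, hΦ⟩ := h
  obtain ⟨Ψ, hΨ⟩ := h'
  have h1 := (hΦ.comp hΨ).eq_id
  have h2 := (hΨ.comp hΦ).eq_id
  refine ⟨Ψ, hΨ, fun y => ⟨Φ y, h2 y⟩, fun x => le_antisymm (hΨ.contractive x) ?_⟩
  conv_lhs => rw [← h1 x]
  exact hΦ.contractive _

theorem HLDBA.trivial_le (𝔄 : HLDBA.{u, v} A) : (HLDBA.trivial.{u, w} A).Le 𝔄 :=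
  ⟨0, fun x => by simp, @continuous_const _ _ (_) (_) _, fun _ => rfl⟩

variable [OperatorSpace A]

theorem OpHLDBA.Le.antisymm {𝔄 𝔅 : OpHLDBA.{u, v} A} (h : 𝔄.Le 𝔅) (h' : 𝔅.Le 𝔄) :
    𝔄.Equiv 𝔅 := by
  obtain ⟨Φ, hΦ⟩ := h
  obtain ⟨Ψ, hΨ⟩ := h'
  have h1 := (hΦ.comp hΨ).isHom.eq_id
  have h2 := (hΨ.comp hΦ).isHom.eq_id
  refine ⟨Ψ, hΨ, fun y => ⟨Φ y, h2 y⟩, fun x => le_antisymm (hΨ.cc x) ?_⟩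
  have : x = (x.map Ψ).map Φ := by
    ext i j
    exact (h1 _).symm
  conv_lhs => rw [this]
  exact hΦ.cc _

theorem OpHLDBA.trivial_le (𝔄 : OpHLDBA.{u, v} A) : (OpHLDBA.trivial.{u, w} A).Le 𝔄 :=
  ⟨0, ⟨fun x => by simp, @continuous_const _ _ (_) (_) _, fun _ => rfl⟩, fun x => mnorm_nonneg x⟩

end Hom

/-! ### Weak-star closed subspaces -/

section AnnihilatorDual

variable {E P W : Type*} [NormedAddCommGroup E] [NormedSpace ℂ E]
  [NormedAddCommGroup P] [NormedSpace ℂ P] [NormedAddCommGroup W] [NormedSpace ℂ W]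

theorem norm_liftQL (N : Submodule ℂ W) [IsClosed (N : Set W)] (f : StrongDual ℂ W)
    (hf : N ≤ f.ker) : ‖N.liftQL f hf‖ = ‖f‖ := by
  refine le_antisymm (ContinuousLinearMap.opNorm_le_bound _ (norm_nonneg _) fun x => ?_)
    (ContinuousLinearMap.opNorm_le_bound _ (ContinuousLinearMap.opNorm_nonneg _) fun w => ?_)
  · refine le_of_forall_pos_le_add fun ε hε => ?_
    -- The representative is chosen so that the error `‖f‖ * δ` is at most `ε`; the `+ 1` covers `f
    -- = 0`.
    have hδ : 0 < ε / (‖f‖ + 1) := by positivity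
    obtain ⟨w, rfl, hw⟩ := Submodule.Quotient.norm_mk_lt x hδ
    have h1 : ‖f w‖ ≤ ‖f‖ * (‖(Submodule.Quotient.mk w : W ⧸ N)‖ + ε / (‖f‖ + 1)) :=
      (f.le_opNorm w).trans (mul_le_mul_of_nonneg_left hw.le (norm_nonneg _))
    have h2 : ‖f‖ * (ε / (‖f‖ + 1)) ≤ ε := by
      rw [mul_div_assoc', div_le_iff₀ (by positivity)]
      nlinarith [norm_nonneg f]
    calc ‖N.liftQL f hf (Submodule.Quotient.mk w)‖ = ‖f w‖ := rfl
      _ ≤ _ := by rw [mul_add] at h1; linarith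
  · calc ‖f w‖ = ‖N.liftQL f hf (Submodule.Quotient.mk w)‖ := rfl
      _ ≤ ‖N.liftQL f hf‖ * ‖(Submodule.Quotient.mk w : W ⧸ N)‖ :=
        ContinuousLinearMap.le_opNorm _ _
      _ ≤ _ := mul_le_mul_of_nonneg_left (Submodule.Quotient.norm_mk_le N w)
        (ContinuousLinearMap.opNorm_nonneg _)

/-- The annihilator of a closed subspace `N` of `W` is the dual of the quotient `W ⧸ N`. -/
def annihilatorDual (d : P ≃ₗᵢ[ℂ] StrongDual ℂ W) (N : Submodule ℂ W) [IsClosed (N : Set W)]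
    (ι : E →ₗᵢ[ℂ] P) (hι : ∀ μ, μ ∈ Set.range ι ↔ ∀ w ∈ N, d μ w = 0) :
    E ≃ₗᵢ[ℂ] StrongDual ℂ (W ⧸ N) :=
  LinearIsometryEquiv.ofSurjective
    { toFun := fun x => N.liftQL (d (ι x)) fun w hw => (hι _).1 ⟨x, rfl⟩ w hw
      map_add' := fun x y => by
        ext q
        obtain ⟨w, rfl⟩ := N.mkQ_surjective q
        change d (ι (x + y)) w = d (ι x) w + d (ι y) w
        rw [map_add, map_add]
        rfl
      map_smul' := fun c x => by
        ext q
        obtain ⟨w, rfl⟩ := N.mkQ_surjective q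
        change d (ι (c • x)) w = c • d (ι x) w
        rw [map_smul, map_smul]
        rfl
      norm_map' := fun x => (norm_liftQL N _ _).trans
        ((d.norm_map _).trans (ι.norm_map x)) }
    fun f => by
      -- A functional on the quotient pulls back to one on `W` that vanishes on `N`, hence comes
      -- from a point in the range of `ι`.
      obtain ⟨x, hx⟩ := (hι (d.symm (f ∘L N.mkQL))).2 fun w hw => by
        rw [LinearIsometryEquiv.apply_symm_apply]
        change f (N.mkQ w) = 0
        rw [(Submodule.Quotient.mk_eq_zero N).2 hw |> (N.mkQ_apply w).trans, map_zero]
      refine ⟨x, ?_⟩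
      ext q
      obtain ⟨w, rfl⟩ := N.mkQ_surjective q
      change d (ι x) w = f (N.mkQ w)
      rw [hx, LinearIsometryEquiv.apply_symm_apply]
      rfl

variable (d : P ≃ₗᵢ[ℂ] StrongDual ℂ W) (N : Submodule ℂ W) [IsClosed (N : Set W)]
    (ι : E →ₗᵢ[ℂ] P) (hι : ∀ μ, μ ∈ Set.range ι ↔ ∀ w ∈ N, d μ w = 0)

/-- Evaluation at a coset is evaluation at any representative, and the quotient map is onto, so both
families of evaluations generate the same topology. -/
theorem weakStar_annihilatorDual :
    weakStar (annihilatorDual d N ι hι) = TopologicalSpace.induced ι (weakStar d) := by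
  rw [weakStar_eq_induced, weakStar_eq_induced, induced_compose]
  simp only [Pi.topologicalSpace, induced_iInf, induced_compose]
  exact (N.mkQ_surjective.iInf_comp fun q => TopologicalSpace.induced
    (fun x => annihilatorDual d N ι hι x q) inferInstance).symm

end AnnihilatorDual

/-! ### Preannihilators and the bipolar theorem for subspaces -/

section Preannihilator

variable {P W : Type*} [NormedAddCommGroup P] [NormedSpace ℂ P] [NormedAddCommGroup W]
  [NormedSpace ℂ W]

/-- The predual elements that annihilate a subspace. -/
def preannihilator (d : P ≃ₗᵢ[ℂ] StrongDual ℂ W) (S : Submodule ℂ P) : Submodule ℂ W where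
  carrier := {w | ∀ ν ∈ S, d ν w = 0}
  add_mem' h h' ν hν := by rw [map_add, h ν hν, h' ν hν, add_zero]
  zero_mem' ν _ := map_zero _
  smul_mem' c w h ν hν := by rw [map_smul, h ν hν, smul_zero]

instance isClosed_preannihilator (d : P ≃ₗᵢ[ℂ] StrongDual ℂ W) (S : Submodule ℂ P) :
    IsClosed (preannihilator d S : Set W) := by
  have : (preannihilator d S : Set W) = ⋂ ν ∈ S, {w | d ν w = 0} := by
    ext w
    simp [preannihilator]
  rw [this]
  exact isClosed_biInter fun ν _ => isClosed_eq (d ν).continuous continuous_const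

/-- One direction holds because kernels of evaluations are weak*-closed, the other is Hahn–Banach
separation. -/
theorem mem_weakStar_closure_iff (d : P ≃ₗᵢ[ℂ] StrongDual ℂ W) (S : Submodule ℂ P) (μ : P) :
    μ ∈ @closure P (weakStar d) S ↔ ∀ w ∈ preannihilator d S, d μ w = 0 := by
  refine ⟨fun hμ w hw => ?_, fun h => mem_weakStar_closure d S μ h⟩
  let := weakStar d
  have hc : IsClosed {μ | d μ w = 0} := isClosed_eq (weakStar_eval d w) continuous_const
  exact closure_minimal (s := (S : Set P)) (fun ν hν => hw ν hν) hc hμ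

end Preannihilator

/-! ### The HLDBA generated by a homomorphism into a dual Banach algebra -/

section Generated

variable {A : Type u} [NonUnitalNormedRing A] [NormedSpace ℂ A] {P : Type v} {W : Type v}
  [NonUnitalNormedRing P] [NormedSpace ℂ P]
  [NormedAddCommGroup W] [NormedSpace ℂ W]

/-- The weak-star closure of the range of a homomorphism that takes its values in the topological
centre. -/
def weakStarClosureRange (d : P ≃ₗᵢ[ℂ] StrongDual ℂ W)
    (hd : ∀ ν : P, Continuous[weakStar d, weakStar d] fun μ => μ * ν) (h : A →ₙₐ[ℂ] P)
    (hc : ∀ a, h a ∈ topologicalCentre d) : NonUnitalSubalgebra ℂ P where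
  carrier := {μ | ∀ w ∈ preannihilator d (LinearMap.range (h : A →ₗ[ℂ] P)), d μ w = 0}
  add_mem' hμ hν w hw := by
    rw [map_add]
    exact (congrArg₂ (· + ·) (hμ w hw) (hν w hw)).trans (add_zero _)
  zero_mem' w _ := by rw [map_zero]; rfl
  smul_mem' c μ hμ w hw := by
    rw [map_smul]
    exact (congrArg (c • ·) (hμ w hw)).trans (smul_zero c)
  mul_mem' {μ ν} hμ hν := by
    set S := LinearMap.range (h : A →ₗ[ℂ] P) with hS
    have key : ∀ μ, (∀ w ∈ preannihilator d S, d μ w = 0) ↔ μ ∈ @closure P (weakStar d) S :=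
      fun μ => (mem_weakStar_closure_iff d S μ).symm
    simp only [Set.mem_ofPred_eq, key] at hμ hν ⊢
    let := weakStar d
    -- The factors move into the closure one at a time: first the right one, against `h a` in the
    -- topological centre, then the left one, by continuity of right multiplication.
    have h1 : ∀ a, ∀ ν ∈ closure (S : Set P), h a * ν ∈ closure (S : Set P) := fun a ν hν => by
      refine map_mem_closure (hc a) hν ?_
      rintro _ ⟨b, rfl⟩
      exact ⟨a * b, map_mul h a b⟩
    have h2 : μ * ν ∈ closure (closure (S : Set P)) := by
      refine map_mem_closure (f := fun μ => μ * ν) (hd ν) hμ ?_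
      rintro _ ⟨a, rfl⟩
      exact h1 a ν hν
    rwa [closure_closure] at h2

variable (d : P ≃ₗᵢ[ℂ] StrongDual ℂ W)
    (hd : ∀ ν : P, Continuous[weakStar d, weakStar d] fun μ => μ * ν) (h : A →ₙₐ[ℂ] P)
    (hc : ∀ a, h a ∈ topologicalCentre d)

theorem coe_weakStarClosureRange :
    (weakStarClosureRange d hd h hc : Set P) = @closure P (weakStar d) (Set.range h) := by
  ext μ
  exact (mem_weakStar_closure_iff d _ μ).symm

instance weakStarClosureRange.normedSpace :
    NormedSpace ℂ (weakStarClosureRange d hd h hc) where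
  norm_smul_le c x := norm_smul_le c (x : P)

/-- The inclusion of `weakStarClosureRange`. -/
def weakStarClosureRange.incl : weakStarClosureRange d hd h hc →ₗᵢ[ℂ] P where
  toFun := Subtype.val
  map_add' _ _ := rfl
  map_smul' _ _ := rfl
  norm_map' _ := rfl

/-- `weakStarClosureRange` is a dual space. -/
def weakStarClosureRange.dual : weakStarClosureRange d hd h hc ≃ₗᵢ[ℂ] StrongDual ℂ
    (W ⧸ preannihilator d (LinearMap.range (h : A →ₗ[ℂ] P))) :=
  annihilatorDual d _ (weakStarClosureRange.incl d hd h hc) fun μ => by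
    change μ ∈ Set.range Subtype.val ↔ _
    rw [Subtype.range_val]
    rfl

theorem weakStarClosureRange.weakStar_dual :
    weakStar (weakStarClosureRange.dual d hd h hc) =
      TopologicalSpace.induced Subtype.val (weakStar d) :=
  weakStar_annihilatorDual _ _ _ _

theorem mem_weakStarClosureRange (a : A) : h a ∈ weakStarClosureRange d hd h hc :=
  fun _ hw => hw _ ⟨a, rfl⟩

variable [IsScalarTower ℂ P P] [SMulCommClass ℂ P P] [CompleteSpace W]

/-- The HLDBA generated by a contractive homomorphism into the topological centre of a
dual Banach algebra whose right multiplications are weak-star continuous. -/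
def HLDBA.generated (hh : ∀ a, ‖h a‖ ≤ ‖a‖) : HLDBA.{u, v} A where
  Carrier := weakStarClosureRange d hd h hc
  Predual := W ⧸ preannihilator d (LinearMap.range (h : A →ₗ[ℂ] P))
  completeSpace :=
    (weakStarClosureRange.dual d hd h hc).toIsometryEquiv.completeSpace
  dual := weakStarClosureRange.dual d hd h hc
  mul_weakStar ν := by
    rw [weakStarClosureRange.weakStar_dual]
    let := weakStar d
    let := TopologicalSpace.induced (Subtype.val : weakStarClosureRange d hd h hc → P) (weakStar d)
    exact continuous_induced_rng.2 ((hd ν).comp continuous_induced_dom)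
  η :=
    { toFun := fun a => ⟨h a, mem_weakStarClosureRange d hd h hc a⟩
      map_smul' := fun c a => Subtype.ext (map_smul h c a)
      map_zero' := Subtype.ext (map_zero h)
      map_add' := fun a b => Subtype.ext (map_add h a b)
      map_mul' := fun a b => Subtype.ext (map_mul h a b) }
  η_contractive := hh
  η_mem_centre a := by
    rw [topologicalCentre, Set.mem_ofPred_eq, weakStarClosureRange.weakStar_dual]
    let := weakStar d
    let := TopologicalSpace.induced (Subtype.val : weakStarClosureRange d hd h hc → P) (weakStar d)
    have hca : Continuous fun ν => h a * ν := hc a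
    exact continuous_induced_rng.2 (hca.comp continuous_induced_dom)
  η_dense x := by
    rw [weakStarClosureRange.weakStar_dual]
    let := weakStar d
    rw [closure_induced, ← Set.range_comp]
    have hx := x.2
    rw [← SetLike.mem_coe, coe_weakStarClosureRange] at hx
    exact hx

end Generated

/-! ### Operator space preduals -/

section PredualOperatorSpace

variable {E V : Type*} [NormedAddCommGroup E] [NormedSpace ℂ E] [NormedAddCommGroup V]
  [NormedSpace ℂ V]

/-- The embedding of a predual into the dual. -/
def predualIncl (d : E ≃ₗᵢ[ℂ] StrongDual ℂ V) : V →ₗᵢ[ℂ] StrongDual ℂ E where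
  toFun v := (NormedSpace.inclusionInDoubleDual ℂ V v) ∘L
    (d.toContinuousLinearEquiv : E →L[ℂ] StrongDual ℂ V)
  map_add' v v' := by ext x; simp
  map_smul' c v := by ext x; simp
  norm_map' v := by
    refine (ContinuousLinearMap.opNorm_comp_linearIsometryEquiv _ d).trans ?_
    exact (NormedSpace.inclusionInDoubleDualLi ℂ).norm_map v

variable [OperatorSpace E]

/-- The matrix norms of `E` are determined by matrices over the predual `V` that are contractive
on `E`. -/
def IsDualMatrixNorm (d : E ≃ₗᵢ[ℂ] StrongDual ℂ V) : Prop :=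
  ∀ (n : ℕ) (x : Matrix (Fin n) (Fin n) E) (r : ℝ), r < mnorm x →
    ∃ (m : ℕ) (v : Matrix (Fin m) (Fin m) V),
      (∀ (k : ℕ) (y : Matrix (Fin k) (Fin k) E), scalarOpNorm
        (Matrix.of fun p q : Fin k × Fin m => d (y p.1 q.1) (v p.2 q.2)) ≤ mnorm y) ∧
      r < scalarOpNorm (Matrix.of fun p q : Fin n × Fin m => d (x p.1 q.1) (v p.2 q.2))

/-- The operator space structure of a predual of `E`, as a subspace of the dual of `E`. -/
@[reducible] def predualOperatorSpace (d : E ≃ₗᵢ[ℂ] StrongDual ℂ V) : OperatorSpace V :=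
  @OperatorSpace.comap _ _ _ _ (dualOperatorSpace E) _ _ (predualIncl d)

/-- The two matrices differ by the tensor flip. This allows a pairing to be read as functionals
acting on vectors or as vectors acting on functionals. -/
theorem scalarOpNorm_of_swap {m n : ℕ} (F : Fin m → Fin m → Fin n → Fin n → ℂ) :
    scalarOpNorm (Matrix.of fun p q : Fin m × Fin n => F p.1 q.1 p.2 q.2) =
      scalarOpNorm (Matrix.of fun p q : Fin n × Fin m => F p.2 q.2 p.1 q.1) :=
  scalarOpNorm_submatrix_equiv (Matrix.of fun p q : Fin n × Fin m => F p.2 q.2 p.1 q.1)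
    (Equiv.prodComm _ _) (Equiv.prodComm _ _)

/-- When `V` has the norms inherited from `E*`, the dual norm cannot exceed the norm of `E`, by the
definition of the former. The hypothesis provides enough contractive test matrices for the converse.
-/
theorem IsDualMatrixNorm.mnorm_eq {d : E ≃ₗᵢ[ℂ] StrongDual ℂ V} (h : IsDualMatrixNorm d) {n : ℕ}
    (x : Matrix (Fin n) (Fin n) E) :
    mnorm x = @dualMNorm _ _ _ (predualOperatorSpace d) _ (x.map d) := by
  let := predualOperatorSpace d
  have hv : ∀ {m : ℕ} (v : Matrix (Fin m) (Fin m) V),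
      mnorm v = dualMNorm (v.map (predualIncl d)) := fun _ => rfl
  refine le_antisymm (le_of_forall_lt fun r hr => ?_) (dualMNorm_le (mnorm_nonneg x) ?_)
  · obtain ⟨m, v, hv1, hv2⟩ := h n x r hr
    have : mnorm v ≤ 1 := by
      rw [hv]
      refine dualMNorm_le zero_le_one fun k y hy => ?_
      refine le_trans (le_of_eq ?_) ((hv1 k y).trans hy)
      exact scalarOpNorm_of_swap fun p q i j => d (y i j) (v p q)
    exact hv2.trans_le (scalarOpNorm_pairing_le_of_le_one (x.map d) this)
  · intro m v hv'
    have h1 := scalarOpNorm_pairing_le (v.map (predualIncl d)) x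
    rw [← hv] at h1
    refine le_trans (le_of_eq ?_) (h1.trans (mul_le_of_le_one_left (mnorm_nonneg x) hv'))
    exact scalarOpNorm_of_swap fun p q i j => d (x p q) (v i j)

theorem isDualMatrixNorm_of_mnorm_eq [OperatorSpace V] {d : E ≃ₗᵢ[ℂ] StrongDual ℂ V}
    (h : ∀ {n : ℕ} (x : Matrix (Fin n) (Fin n) E), mnorm x = dualMNorm (x.map d)) :
    IsDualMatrixNorm d := by
  intro n x r hr
  rw [h, dualMNorm] at hr
  -- A near-optimal test matrix is picked; the matrix of size `0` shows that the supremum is over a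
  -- nonempty set.
  obtain ⟨_, ⟨m, v, hv, rfl⟩, hlt⟩ := exists_lt_of_lt_csSup
    (by exact ⟨_, 0, 0, mnorm_zero.trans_le zero_le_one, rfl⟩) hr
  refine ⟨m, v, fun k y => ?_, hlt⟩
  rw [h]
  exact scalarOpNorm_pairing_le_of_le_one (y.map d) hv

end PredualOperatorSpace

/-! ### The `ℓ^∞`-product of dual spaces -/

section LpDual

theorem lp.summable_norm_one {I : Type*} {V : I → Type*} [∀ i, NormedAddCommGroup (V i)]
    (x : lp V 1) : Summable fun i => ‖x i‖ := by
  simpa using (lp.memℓp x).summable (by simp)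

theorem lp.norm_eq_tsum_one {I : Type*} {V : I → Type*} [∀ i, NormedAddCommGroup (V i)]
    (x : lp V 1) : ‖x‖ = ∑' i, ‖x i‖ := by
  simpa using lp.norm_eq_tsum_rpow (by simp) x

variable {I : Type*} {E V : I → Type*} [∀ i, NormedAddCommGroup (E i)] [∀ i, NormedSpace ℂ (E i)]
  [∀ i, NormedAddCommGroup (V i)] [∀ i, NormedSpace ℂ (V i)]
  (d : ∀ i, E i ≃ₗᵢ[ℂ] StrongDual ℂ (V i))

theorem norm_lpPairing_le (μ : lp E ∞) (x : lp V 1) (i : I) :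
    ‖d i (μ i) (x i)‖ ≤ ‖μ‖ * ‖x i‖ := by
  refine ((d i (μ i)).le_opNorm _).trans ?_
  rw [LinearIsometryEquiv.norm_map]
  exact mul_le_mul_of_nonneg_right (lp.norm_apply_le_norm ENNReal.top_ne_zero μ i) (norm_nonneg _)

theorem summable_lpPairing (μ : lp E ∞) (x : lp V 1) : Summable fun i => d i (μ i) (x i) :=
  Summable.of_norm_bounded ((lp.summable_norm_one x).mul_left ‖μ‖) (norm_lpPairing_le d μ x)

/-- The functional on the `ℓ¹`-sum given by an element of the `ℓ^∞`-product. -/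
def lpPairing (μ : lp E ∞) : StrongDual ℂ (lp V 1) :=
  LinearMap.mkContinuous
    { toFun := fun x => ∑' i, d i (μ i) (x i)
      map_add' := fun x y => by
        rw [← (summable_lpPairing d μ x).tsum_add (summable_lpPairing d μ y)]
        simp
      map_smul' := fun c x => by
        rw [RingHom.id_apply, ← (summable_lpPairing d μ x).tsum_const_smul]
        simp } ‖μ‖ fun x => by
    rw [lp.norm_eq_tsum_one, ← tsum_mul_left]
    exact tsum_of_norm_bounded ((lp.summable_norm_one x).mul_left ‖μ‖).hasSum
      (norm_lpPairing_le d μ x)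

theorem lpPairing_apply (μ : lp E ∞) (x : lp V 1) : lpPairing d μ x = ∑' i, d i (μ i) (x i) := rfl

theorem lpPairing_single [DecidableEq I] (μ : lp E ∞) (i : I) (x : V i) :
    lpPairing d μ (lp.single 1 i x) = d i (μ i) x := by
  rw [lpPairing_apply, tsum_eq_single i]
  · rw [lp.single_apply_self]
  · intro k hk
    rw [lp.single_apply_ne _ _ _ hk, map_zero]

/-- The lower bound comes from testing on vectors supported at a single coordinate. -/
theorem norm_lpPairing (μ : lp E ∞) : ‖lpPairing d μ‖ = ‖μ‖ := by
  classical
  refine le_antisymm (LinearMap.mkContinuous_norm_le _ (norm_nonneg _) _) ?_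
  refine lp.norm_le_of_forall_le (norm_nonneg _) fun i => ?_
  rw [← (d i).norm_map]
  refine ContinuousLinearMap.opNorm_le_bound _ (norm_nonneg _) fun x => ?_
  rw [← lpPairing_single]
  refine ((lpPairing d μ).le_opNorm _).trans_eq ?_
  rw [lp.norm_single (by simp)]

/-- The restrictions of `f` to the coordinates are bounded by `‖f‖`, and they determine `f` because
each vector of the ℓ¹-sum is the sum of its coordinate vectors. -/
theorem lpPairing_surjective (f : StrongDual ℂ (lp V 1)) : ∃ μ, lpPairing d μ = f := by
  classical
  let g : ∀ i, StrongDual ℂ (V i) := fun i =>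
    LinearMap.mkContinuous (f.toLinearMap ∘ₗ lp.lsingle 1 i) ‖f‖ fun x =>
      (f.le_opNorm _).trans_eq (by rw [lp.lsingle_apply, lp.norm_single (by simp)])
  have hg : ∀ i x, g i x = f (lp.single 1 i x) := fun _ _ => rfl
  let μ : lp E ∞ := ⟨fun i => (d i).symm (g i), memℓp_infty ⟨‖f‖, by
    rintro _ ⟨i, rfl⟩
    dsimp only
    rw [LinearIsometryEquiv.norm_map]
    exact LinearMap.mkContinuous_norm_le _ (norm_nonneg _) _⟩⟩
  refine ⟨μ, ?_⟩
  ext x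
  have h := f.hasSum (lp.hasSum_single (by simp) x)
  rw [← h.tsum_eq, lpPairing_apply]
  refine tsum_congr fun i => ?_
  change d i ((d i).symm (g i)) (x i) = _
  rw [LinearIsometryEquiv.apply_symm_apply, hg]

/-- The `ℓ^∞`-product of dual spaces is the dual of the `ℓ¹`-sum of the preduals. -/
def lpDual : lp E ∞ ≃ₗᵢ[ℂ] StrongDual ℂ (lp V 1) :=
  LinearIsometryEquiv.ofSurjective
    { toFun := lpPairing d
      map_add' := fun μ ν => by
        ext x
        rw [add_apply, lpPairing_apply, lpPairing_apply, lpPairing_apply,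
          ← (summable_lpPairing d μ x).tsum_add (summable_lpPairing d ν x)]
        simp
      map_smul' := fun c μ => by
        ext x
        rw [RingHom.id_apply, smul_apply, lpPairing_apply, lpPairing_apply,
          ← (summable_lpPairing d μ x).tsum_const_smul]
        simp
      norm_map' := norm_lpPairing d } (lpPairing_surjective d)

theorem lpDual_apply (μ : lp E ∞) (x : lp V 1) : lpDual d μ x = ∑' i, d i (μ i) (x i) := rfl

theorem lpDual_single [DecidableEq I] (μ : lp E ∞) (i : I) (x : V i) :
    lpDual d μ (lp.single 1 i x) = d i (μ i) x := lpPairing_single d μ i x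

theorem weakStar_continuous_lp_apply (i : I) :
    Continuous[weakStar (lpDual d), weakStar (d i)] fun μ => μ i := by
  classical
  rw [weakStar_continuous_iff]
  intro x
  simp only [← lpDual_single]
  exact weakStar_eval (lpDual d) _

/-- A bounded linear map into an `ℓ^∞`-product is weak-star continuous if its coordinates are. -/
theorem weakStar_continuous_lp {F U : Type*} [NormedAddCommGroup F] [NormedSpace ℂ F]
    [NormedAddCommGroup U] [NormedSpace ℂ U] [CompleteSpace U] (d' : F ≃ₗᵢ[ℂ] StrongDual ℂ U)
    (T : F →ₗ[ℂ] lp E ∞) {C : ℝ} (hC : 0 ≤ C) (hT : ∀ b, ‖T b‖ ≤ C * ‖b‖)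
    (h : ∀ i, Continuous[weakStar d', weakStar (d i)] fun b => T b i) :
    Continuous[weakStar d', weakStar (lpDual d)] T := by
  rw [weakStar_continuous_iff]
  intro x
  -- Here `y i` is the pre-adjoint of the `i`-th coordinate applied to `x i`. The bound on `T` makes
  -- these summable in the complete space `U`, so pairing with `x` becomes evaluation at their sum.
  have hex : ∀ i, ∃ y : U, ∀ b, d i (T b i) (x i) = d' b y := fun i =>
    weakStar_functional d'
      { toFun := fun b => d i (T b i) (x i)
        map_add' := fun a b => by simp
        map_smul' := fun c b => by simp }
      ((weakStar_continuous_iff d' (d i) _).1 (h i) (x i))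
  choose y hy using hex
  have hle : ∀ i, ‖y i‖ ≤ C * ‖x i‖ := fun i => by
    refine NormedSpace.norm_le_dual_bound ℂ _ (mul_nonneg hC (norm_nonneg _)) fun f => ?_
    have hf := hy i (d'.symm f)
    rw [LinearIsometryEquiv.apply_symm_apply] at hf
    rw [← hf]
    refine (norm_lpPairing_le d _ x i).trans ?_
    refine (mul_le_mul_of_nonneg_right (hT _) (norm_nonneg _)).trans_eq ?_
    rw [LinearIsometryEquiv.norm_map]
    ring
  have hs : Summable y := Summable.of_norm_bounded ((lp.summable_norm_one x).mul_left C) hle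
  have he : (fun b => lpDual d (T b) x) = fun b => d' b (∑' i, y i) := by
    funext b
    rw [lpDual_apply, (d' b).map_tsum hs]
    exact tsum_congr fun i => hy i b
  rw [he]
  exact weakStar_eval d' _

end LpDual

/-! ### Matrix norms of the ℓ^∞-product -/

section LpOperatorSpace

variable {I : Type*} {E V : I → Type*} [∀ i, NormedAddCommGroup (E i)] [∀ i, NormedSpace ℂ (E i)]
  [∀ i, NormedAddCommGroup (V i)] [∀ i, NormedSpace ℂ (V i)] [∀ i, OperatorSpace (E i)]

/-- A coordinate of a matrix over an `ℓ^∞`-product. -/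
def lpCoord {n : ℕ} (x : Matrix (Fin n) (Fin n) (lp E ∞)) (i : I) : Matrix (Fin n) (Fin n) (E i) :=
  Matrix.of fun k l => (x k l : ∀ i, E i) i

theorem bddAbove_mnorm_lpCoord {n : ℕ} (x : Matrix (Fin n) (Fin n) (lp E ∞)) :
    BddAbove (Set.range fun i => mnorm (lpCoord x i)) := by
  refine ⟨∑ k, ∑ l, ‖x k l‖, ?_⟩
  rintro _ ⟨i, rfl⟩
  exact (mnorm_le_sum_norm _).trans (Finset.sum_le_sum fun k _ => Finset.sum_le_sum fun l _ =>
    lp.norm_apply_le_norm ENNReal.top_ne_zero (x k l) i)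

theorem mnorm_lpCoord_le {n : ℕ} (x : Matrix (Fin n) (Fin n) (lp E ∞)) (i : I) :
    mnorm (lpCoord x i) ≤ ⨆ i, mnorm (lpCoord x i) :=
  le_ciSup (bddAbove_mnorm_lpCoord x) i

theorem iSup_mnorm_lpCoord_nonneg {n : ℕ} (x : Matrix (Fin n) (Fin n) (lp E ∞)) :
    0 ≤ ⨆ i, mnorm (lpCoord x i) :=
  Real.iSup_nonneg fun _ => mnorm_nonneg _

variable (E) in
/-- The `ℓ^∞`-product of operator spaces. -/
@[reducible] def lpOperatorSpace : OperatorSpace (lp E ∞) where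
  mnorm x := ⨆ i, mnorm (lpCoord x i)
  mnorm_one x := by
    rw [lp.norm_eq_ciSup]
    exact iSup_congr fun i => mnorm_one (x i)
  mnorm_add_le x y :=
    Real.iSup_le (fun i => (mnorm_add_le (lpCoord x i) (lpCoord y i)).trans
      (add_le_add (mnorm_lpCoord_le x i) (mnorm_lpCoord_le y i)))
      (add_nonneg (iSup_mnorm_lpCoord_nonneg x) (iSup_mnorm_lpCoord_nonneg y))
  mnorm_smul c x := by
    rw [Real.mul_iSup_of_nonneg (norm_nonneg c)]
    exact iSup_congr fun i => mnorm_smul c (lpCoord x i)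
  eq_zero_of_mnorm_eq_zero x hx := by
    ext k l i
    have h := eq_zero_of_mnorm_eq_zero (lpCoord x i)
      (le_antisymm ((mnorm_lpCoord_le x i).trans_eq hx) (mnorm_nonneg _))
    exact congrFun (congrFun h k) l
  mnorm_directSum {m n} x y := by
    have h : ∀ i, mnorm (lpCoord ((Matrix.fromBlocks x 0 0 y).submatrix finSumFinEquiv.symm
        finSumFinEquiv.symm) i) = max (mnorm (lpCoord x i)) (mnorm (lpCoord y i)) := fun i => by
      rw [← mnorm_directSum]
      congr 1
      ext p q
      obtain ⟨p, rfl⟩ := finSumFinEquiv.surjective p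
      obtain ⟨q, rfl⟩ := finSumFinEquiv.surjective q
      rcases p with p | p <;> rcases q with q | q <;> simp [lpCoord]
    have h0 : 0 ≤ max (⨆ i, mnorm (lpCoord x i)) (⨆ i, mnorm (lpCoord y i)) :=
      le_max_of_le_left (iSup_mnorm_lpCoord_nonneg x)
    refine le_antisymm (Real.iSup_le (fun i => ?_) h0) (max_le ?_ ?_)
    · rw [h]
      exact max_le_max (mnorm_lpCoord_le x i) (mnorm_lpCoord_le y i)
    · refine Real.iSup_le (fun i => ?_) (iSup_mnorm_lpCoord_nonneg _)
      refine le_trans ?_ (mnorm_lpCoord_le _ i)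
      rw [h]
      exact le_max_left _ _
    · refine Real.iSup_le (fun i => ?_) (iSup_mnorm_lpCoord_nonneg _)
      refine le_trans ?_ (mnorm_lpCoord_le _ i)
      rw [h]
      exact le_max_right _ _
  mnorm_mul_le α x β := by
    refine Real.iSup_le (fun i => ?_) (mul_nonneg (mul_nonneg (scalarOpNorm_nonneg _)
      (iSup_mnorm_lpCoord_nonneg x)) (scalarOpNorm_nonneg _))
    have h := mnorm_mul_le α (lpCoord x i) β
    have he : lpCoord (Matrix.of fun i j => ∑ k, ∑ l, (α i k * β l j) • x k l) i =
        Matrix.of fun i' j => ∑ k, ∑ l, (α i' k * β l j) • lpCoord x i k l := by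
      ext p q
      simp only [lpCoord, Matrix.of_apply]
      rw [lp.coeFn_sum, Finset.sum_apply]
      refine Finset.sum_congr rfl fun k _ => ?_
      rw [lp.coeFn_sum, Finset.sum_apply]
      rfl
    rw [he]
    refine h.trans (mul_le_mul_of_nonneg_right (mul_le_mul_of_nonneg_left (mnorm_lpCoord_le x i)
      (scalarOpNorm_nonneg _)) (scalarOpNorm_nonneg _))

/-- A matrix norm of the product is almost attained at one coordinate `i`. A test matrix over the
`i`-th predual, placed at position `i` of the ℓ¹-sum, is still contractive on the whole product. -/
theorem isDualMatrixNorm_lpDual {d : ∀ i, E i ≃ₗᵢ[ℂ] StrongDual ℂ (V i)}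
    (h : ∀ i, IsDualMatrixNorm (d i)) :
    @IsDualMatrixNorm _ _ _ _ _ _ (lpOperatorSpace E) (lpDual d) := by
  classical
  let := lpOperatorSpace E
  have hm : ∀ {n : ℕ} (x : Matrix (Fin n) (Fin n) (lp E ∞)), mnorm x = ⨆ i, mnorm (lpCoord x i) :=
    fun _ => rfl
  intro n x r hr
  -- For `r < 0` the empty test matrix suffices. This covers an empty index set, where there is no
  -- coordinate to choose.
  rcases lt_or_ge r 0 with h0 | h0
  · refine ⟨0, 0, fun k y => ?_, h0.trans_le (scalarOpNorm_nonneg _)⟩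
    refine le_trans (le_of_eq ?_) (mnorm_nonneg y)
    rw [← scalarOpNorm_zero (m := Fin k × Fin 0) (n := Fin k × Fin 0)]
    congr 1
    ext p
    exact p.2.elim0
  · obtain ⟨i, hi⟩ : ∃ i, r < mnorm (lpCoord x i) := by
      by_contra! hcon
      exact hr.not_ge (Real.iSup_le hcon h0)
    obtain ⟨m, v, hv, hlt⟩ := h i n _ r hi
    refine ⟨m, v.map (lp.single 1 i), fun k y => ?_, ?_⟩
    · simp only [Matrix.map_apply, lpDual_single]
      exact (hv k (lpCoord y i)).trans (mnorm_lpCoord_le y i)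
    · simp only [Matrix.map_apply, lpDual_single]
      exact hlt

end LpOperatorSpace

theorem completelyContractiveMul_lp {I : Type*} {E : I → Type*} [∀ i, NonUnitalNormedRing (E i)]
    [∀ i, NormedSpace ℂ (E i)] [∀ i, OperatorSpace (E i)]
    (h : ∀ i, CompletelyContractiveMul (E i)) :
    @CompletelyContractiveMul (lp E ∞) _ _ (lpOperatorSpace E) := by
  intro m n x y
  refine Real.iSup_le (fun i => ?_)
    (mul_nonneg (iSup_mnorm_lpCoord_nonneg x) (iSup_mnorm_lpCoord_nonneg y))
  exact (h i m n (lpCoord x i) (lpCoord y i)).trans (mul_le_mul (mnorm_lpCoord_le x i)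
    (mnorm_lpCoord_le y i) (mnorm_nonneg _) (iSup_mnorm_lpCoord_nonneg x))

/-! ### Transfer to another universe -/

section Transfer

variable {A : Type u} [NonUnitalNormedRing A] [NormedSpace ℂ A]

/-- A normed ring structure transported along a bijection. -/
@[reducible] def Equiv.nonUnitalNormedRing {X : Type v} {Y : Type w} (e : X ≃ Y)
    [NonUnitalNormedRing Y] : NonUnitalNormedRing X :=
  { e.normedAddCommGroup, e.nonUnitalRing with
    norm_mul_le := fun x y => by
      change ‖e (e.symm (e x * e y))‖ ≤ ‖e x‖ * ‖e y‖
      rw [e.apply_symm_apply]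
      exact norm_mul_le _ _ }

/-- The bijection as an isometry for the transported structure. -/
def Equiv.toLinearIsometryEquivTransport {X : Type v} {Y : Type w} (e : X ≃ Y)
    [NormedAddCommGroup Y] [NormedSpace ℂ Y] :
    letI := e.normedAddCommGroup
    letI := e.normedSpace ℂ
    X ≃ₗᵢ[ℂ] Y :=
  letI := e.normedAddCommGroup
  letI := e.normedSpace ℂ
  { e with
    map_add' := fun _ _ => e.apply_symm_apply _
    map_smul' := fun _ _ => e.apply_symm_apply _
    norm_map' := fun _ => rfl }

/-- Precomposition with an isometric isomorphism. -/
def LinearIsometryEquiv.dualMap {X : Type v} {Y : Type w} [NormedAddCommGroup X] [NormedSpace ℂ X]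
    [NormedAddCommGroup Y] [NormedSpace ℂ Y] (e : X ≃ₗᵢ[ℂ] Y) :
    StrongDual ℂ Y ≃ₗᵢ[ℂ] StrongDual ℂ X where
  toFun f := f ∘L (e.toContinuousLinearEquiv : X →L[ℂ] Y)
  invFun f := f ∘L (e.symm.toContinuousLinearEquiv : Y →L[ℂ] X)
  map_add' f g := rfl
  map_smul' c f := rfl
  left_inv f := by ext; simp
  right_inv f := by ext; simp
  norm_map' f := ContinuousLinearMap.opNorm_comp_linearIsometryEquiv f e

variable (𝔄 : HLDBA.{u, v} A) {C Q : Type w} (eC : C ≃ 𝔄.Carrier) (eQ : Q ≃ 𝔄.Predual)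

/-- An HLDBA transported along bijections of the algebra and the predual. -/
def HLDBA.transfer : HLDBA.{u, w} A :=
  letI := eC.nonUnitalNormedRing
  letI : NormedSpace ℂ C := eC.normedSpace ℂ
  letI := eQ.normedAddCommGroup
  letI := eQ.normedSpace ℂ
  let iC : C ≃ₗᵢ[ℂ] 𝔄.Carrier := eC.toLinearIsometryEquivTransport
  let iQ : Q ≃ₗᵢ[ℂ] 𝔄.Predual := eQ.toLinearIsometryEquivTransport
  have hmul : ∀ x y : C, iC (x * y) = iC x * iC y := fun x y => eC.apply_symm_apply _
  let d := (iC.trans 𝔄.dual).trans iQ.dualMap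
  -- Since `iQ` is onto, the new evaluations are exactly the old ones composed with `iC`.
  have hw : weakStar d = TopologicalSpace.induced iC (weakStar 𝔄.dual) := by
    rw [weakStar_eq_induced, weakStar_eq_induced, induced_compose]
    simp only [Pi.topologicalSpace, induced_iInf, induced_compose]
    exact iQ.surjective.iInf_comp fun q => TopologicalSpace.induced
      (fun x => 𝔄.dual (iC x) q) inferInstance
  have hcont : ∀ (f : C → C) (g : 𝔄.Carrier → 𝔄.Carrier), (∀ x, iC (f x) = g (iC x)) →
      Continuous[weakStar 𝔄.dual, weakStar 𝔄.dual] g → Continuous[weakStar d, weakStar d] f := by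
    intro f g hfg hg
    rw [hw]
    let := weakStar 𝔄.dual
    let := TopologicalSpace.induced iC (weakStar 𝔄.dual)
    refine continuous_induced_rng.2 ?_
    have : (iC ∘ f) = g ∘ iC := funext hfg
    rw [this]
    exact hg.comp continuous_induced_dom
  { Carrier := C
    Predual := Q
    isScalarTower := ⟨fun c x y => iC.injective (by
      simp only [smul_eq_mul, hmul, map_smul, smul_mul_assoc])⟩
    smulCommClass := ⟨fun c x y => iC.injective (by
      simp only [smul_eq_mul, hmul, map_smul, mul_smul_comm])⟩
    completeSpace := iC.toIsometryEquiv.completeSpace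
    predualComplete := iQ.toIsometryEquiv.completeSpace
    dual := d
    mul_weakStar := fun ν => hcont _ _ (fun μ => hmul μ ν) (𝔄.mul_weakStar (iC ν))
    η :=
      { toFun := fun a => iC.symm (𝔄.η a)
        map_smul' := fun c a => by simp
        map_zero' := by simp
        map_add' := fun a b => by simp
        map_mul' := fun a b => iC.injective (by rw [hmul]; simp) }
    η_contractive := fun a => (iC.symm.norm_map _).trans_le (𝔄.η_contractive a)
    η_mem_centre := fun a => hcont _ _
      (fun ν => (hmul _ _).trans (congrArg (· * iC ν) (iC.apply_symm_apply (𝔄.η a))))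
      (𝔄.η_mem_centre a)
    η_dense := fun x => by
      rw [hw]
      let := weakStar 𝔄.dual
      rw [closure_induced, ← Set.range_comp]
      have : iC ∘ (fun a => iC.symm (𝔄.η a)) = 𝔄.η := funext fun a => iC.apply_symm_apply _
      change iC x ∈ closure (Set.range (iC ∘ (fun a => iC.symm (𝔄.η a))))
      rw [this]
      exact 𝔄.η_dense (iC x) }

/-- The isometry from the transported HLDBA. -/
def HLDBA.transferCarrier : (𝔄.transfer eC eQ).Carrier ≃ₗᵢ[ℂ] 𝔄.Carrier := eC.toLinearIsometryEquivTransport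

/-- The isometry from the predual of the transported HLDBA. -/
def HLDBA.transferPredual : (𝔄.transfer eC eQ).Predual ≃ₗᵢ[ℂ] 𝔄.Predual := eQ.toLinearIsometryEquivTransport

theorem HLDBA.transfer_dual (x : (𝔄.transfer eC eQ).Carrier) (q : (𝔄.transfer eC eQ).Predual) :
    (𝔄.transfer eC eQ).dual x q =
      𝔄.dual (𝔄.transferCarrier eC eQ x) (𝔄.transferPredual eC eQ q) := rfl

theorem HLDBA.transferCarrier_mul (x y : (𝔄.transfer eC eQ).Carrier) :
    𝔄.transferCarrier eC eQ (x * y) = 𝔄.transferCarrier eC eQ x * 𝔄.transferCarrier eC eQ y :=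
  eC.apply_symm_apply _

theorem HLDBA.transferCarrier_η (a : A) :
    𝔄.transferCarrier eC eQ ((𝔄.transfer eC eQ).η a) = 𝔄.η a :=
  eC.apply_symm_apply _

theorem HLDBA.isHom_transfer : 𝔄.IsHom (𝔄.transfer eC eQ)
    (𝔄.transferCarrier eC eQ).symm.toLinearEquiv.toLinearMap where
  contractive x := ((𝔄.transferCarrier eC eQ).symm.norm_map x).le
  weakStar := by
    rw [weakStar_continuous_iff]
    intro q
    have : (fun μ => (𝔄.transfer eC eQ).dual ((𝔄.transferCarrier eC eQ).symm μ) q) =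
        fun μ => 𝔄.dual μ (𝔄.transferPredual eC eQ q) := by
      funext μ
      rw [transfer_dual, LinearIsometryEquiv.apply_symm_apply]
    exact (congrArg (Continuous[_root_.weakStar 𝔄.dual, inferInstance]) this).mpr
      (weakStar_eval 𝔄.dual _)
  comp_η a := by
    apply (𝔄.transferCarrier eC eQ).injective
    rw [transferCarrier_η]
    exact (𝔄.transferCarrier eC eQ).apply_symm_apply _

theorem HLDBA.equiv_transfer : 𝔄.Equiv (𝔄.transfer eC eQ) :=
  ⟨_, 𝔄.isHom_transfer eC eQ, (𝔄.transferCarrier eC eQ).symm.surjective,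
    (𝔄.transferCarrier eC eQ).symm.norm_map⟩

/-- The pre-adjoint of `η`, from the predual of an HLDBA to the dual of `A`. -/
def HLDBA.preadjoint : 𝔄.Predual →ₗ[ℂ] StrongDual ℂ A where
  toFun v := LinearMap.mkContinuous
    { toFun := fun a => 𝔄.dual (𝔄.η a) v
      map_add' := fun a b => by simp
      map_smul' := fun c a => by simp } ‖v‖ fun a => by
    refine ((𝔄.dual (𝔄.η a)).le_opNorm v).trans ?_
    rw [LinearIsometryEquiv.norm_map, mul_comm]
    exact mul_le_mul_of_nonneg_left (𝔄.η_contractive a) (norm_nonneg _)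
  map_add' v v' := by ext a; simp
  map_smul' c v := by ext a; simp

theorem HLDBA.norm_preadjoint_le (v : 𝔄.Predual) : ‖𝔄.preadjoint v‖ ≤ ‖v‖ :=
  ContinuousLinearMap.opNorm_le_bound _ (norm_nonneg _) fun a => by
    refine ((𝔄.dual (𝔄.η a)).le_opNorm v).trans ?_
    rw [LinearIsometryEquiv.norm_map, mul_comm]
    exact mul_le_mul_of_nonneg_left (𝔄.η_contractive a) (norm_nonneg _)

/-- An evaluation that vanishes on `η(A)` vanishes on its weak*-closure, which is everything. -/
theorem HLDBA.preadjoint_injective : Function.Injective 𝔄.preadjoint := by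
  rw [injective_iff_map_eq_zero]
  intro v hv
  refine SeparatingDual.eq_zero_of_forall_dual_eq_zero (R := ℂ) fun f => ?_
  let := weakStar 𝔄.dual
  have h : (fun μ => 𝔄.dual μ v) = fun _ => 0 :=
    Continuous.ext_on 𝔄.η_dense (weakStar_eval 𝔄.dual v) continuous_const (by
      rintro _ ⟨a, rfl⟩
      exact DFunLike.congr_fun hv a)
  have := congrFun h (𝔄.dual.symm f)
  rwa [LinearIsometryEquiv.apply_symm_apply] at this

/-- The predual embeds into `A*` and the algebra into the functions on the predual, so `A` alone
bounds the size of an HLDBA. This is why the classes form a set. -/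
theorem HLDBA.small_predual : Small.{u} 𝔄.Predual := small_of_injective 𝔄.preadjoint_injective

theorem HLDBA.small_carrier : Small.{u} 𝔄.Carrier := by
  have := 𝔄.small_predual
  have : Function.Injective fun (μ : 𝔄.Carrier) (v : 𝔄.Predual) => 𝔄.dual μ v :=
    DFunLike.coe_injective.comp 𝔄.dual.injective
  exact small_of_injective this

/-- An isomorphic copy of an HLDBA in the universe of `A`. -/
def HLDBA.shrink : HLDBA.{u, u} A :=
  haveI := 𝔄.small_carrier
  haveI := 𝔄.small_predual
  𝔄.transfer (equivShrink.{u} 𝔄.Carrier).symm (equivShrink.{u} 𝔄.Predual).symm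

theorem HLDBA.exists_isHom_shrink : ∃ Φ : 𝔄.Carrier →ₗ[ℂ] 𝔄.shrink.Carrier,
    𝔄.IsHom 𝔄.shrink Φ ∧ Function.Surjective Φ ∧ ∀ x, ‖Φ x‖ = ‖x‖ :=
  HLDBA.equiv_transfer _ _ _

end Transfer

/-! ### Transfer of operator HLDBAs -/

section OpTransfer

variable {A : Type u} [NonUnitalNormedRing A] [NormedSpace ℂ A] [OperatorSpace A]

/-- An operator HLDBA transported along bijections of the algebra and the predual. -/
def OpHLDBA.transfer (𝔄 : OpHLDBA.{u, v} A) {C Q : Type w} (eC : C ≃ 𝔄.Carrier)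
    (eQ : Q ≃ 𝔄.Predual) : OpHLDBA.{u, w} A :=
  { 𝔄.toHLDBA.transfer eC eQ with
    opCarrier := OperatorSpace.comap (𝔄.toHLDBA.transferCarrier eC eQ).toLinearIsometry
    opPredual := OperatorSpace.comap (𝔄.toHLDBA.transferPredual eC eQ).toLinearIsometry
    mnorm_eq_dual := fun {n} x => by
      let iQ := 𝔄.toHLDBA.transferPredual eC eQ
      refine (𝔄.mnorm_eq_dual (x.map (𝔄.toHLDBA.transferCarrier eC eQ))).trans ?_
      -- Test matrices over the two preduals correspond under `iQ`, so both suprema are over the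
      -- same set of reals.
      unfold dualMNorm
      congr 1
      ext r
      constructor
      · rintro ⟨m, v, hv, rfl⟩
        have hvv : (v.map iQ.symm).map iQ = v := by
          ext i j
          exact iQ.apply_symm_apply _
        refine ⟨m, v.map iQ.symm, (congrArg mnorm hvv).trans_le hv, ?_⟩
        congr 1
        ext p q
        exact congrArg (𝔄.dual (𝔄.toHLDBA.transferCarrier eC eQ (x p.1 q.1)))
          (iQ.apply_symm_apply (v p.2 q.2)).symm
      · rintro ⟨m, v, hv, rfl⟩
        exact ⟨m, v.map iQ, hv, rfl⟩
    mul_cc := fun m n x y => by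
      refine le_of_eq_of_le (congrArg (mnorm (E := 𝔄.Carrier)) ?_) (𝔄.mul_cc m n
        (x.map (𝔄.toHLDBA.transferCarrier eC eQ)) (y.map (𝔄.toHLDBA.transferCarrier eC eQ)))
      ext p q
      exact 𝔄.toHLDBA.transferCarrier_mul eC eQ _ _
    η_cc := fun x => by
      refine le_of_eq_of_le (congrArg (mnorm (E := 𝔄.Carrier)) ?_) (𝔄.η_cc x)
      ext p q
      exact 𝔄.toHLDBA.transferCarrier_η eC eQ _ }

theorem OpHLDBA.equiv_transfer (𝔄 : OpHLDBA.{u, v} A) {C Q : Type w} (eC : C ≃ 𝔄.Carrier)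
    (eQ : Q ≃ 𝔄.Predual) : 𝔄.Equiv (𝔄.transfer eC eQ) := by
  have h : ∀ {n : ℕ} (x : Matrix (Fin n) (Fin n) 𝔄.Carrier),
      (mnorm (x.map (𝔄.toHLDBA.transferCarrier eC eQ).symm :
        Matrix (Fin n) (Fin n) (𝔄.transfer eC eQ).Carrier)) = mnorm x := by
    intro n x
    refine congrArg mnorm (?_ : (x.map _).map _ = x)
    ext i j
    exact (𝔄.toHLDBA.transferCarrier eC eQ).apply_symm_apply _
  exact ⟨(𝔄.toHLDBA.transferCarrier eC eQ).symm.toLinearEquiv.toLinearMap,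
    ⟨𝔄.toHLDBA.isHom_transfer eC eQ, fun x => (h x).le⟩,
    (𝔄.toHLDBA.transferCarrier eC eQ).symm.surjective, h⟩

/-- An isomorphic copy of an operator HLDBA in the universe of `A`. -/
def OpHLDBA.shrink (𝔄 : OpHLDBA.{u, v} A) : OpHLDBA.{u, u} A :=
  haveI := 𝔄.toHLDBA.small_carrier
  haveI := 𝔄.toHLDBA.small_predual
  𝔄.transfer (equivShrink.{u} 𝔄.Carrier).symm (equivShrink.{u} 𝔄.Predual).symm

theorem OpHLDBA.equiv_shrink (𝔄 : OpHLDBA.{u, v} A) : 𝔄.Equiv 𝔄.shrink :=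
  OpHLDBA.equiv_transfer _ _ _

end OpTransfer

/-! ### Subdirect products -/

section OpGenerated

variable {A : Type u} [NonUnitalNormedRing A] [NormedSpace ℂ A] [OperatorSpace A]
  {P : Type v} {W : Type v}
  [NonUnitalNormedRing P] [NormedSpace ℂ P] [IsScalarTower ℂ P P] [SMulCommClass ℂ P P]
  [OperatorSpace P] [NormedAddCommGroup W] [NormedSpace ℂ W] [CompleteSpace W]

/-- A test matrix over `W` can be replaced by its image in `W ⧸ N`, because elements of the
annihilator do not see `N`. -/
theorem isDualMatrixNorm_annihilatorDual {E P W : Type*} [NormedAddCommGroup E] [NormedSpace ℂ E]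
    [NormedAddCommGroup P] [NormedSpace ℂ P] [NormedAddCommGroup W] [NormedSpace ℂ W]
    [OperatorSpace P] {d : P ≃ₗᵢ[ℂ] StrongDual ℂ W} (hd : IsDualMatrixNorm d)
    (N : Submodule ℂ W) [IsClosed (N : Set W)] (ι : E →ₗᵢ[ℂ] P)
    (hι : ∀ μ, μ ∈ Set.range ι ↔ ∀ w ∈ N, d μ w = 0) :
    @IsDualMatrixNorm _ _ _ _ _ _ (OperatorSpace.comap ι) (annihilatorDual d N ι hι) := by
  intro n x r hr
  obtain ⟨m, v, hv, hlt⟩ := hd n (x.map ι) r hr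
  exact ⟨m, v.map N.mkQ, fun k y => hv k (y.map ι), hlt⟩

/-- The operator HLDBA generated by a completely contractive homomorphism into the topological
centre of a dual completely contractive Banach algebra. -/
def OpHLDBA.generated {d : P ≃ₗᵢ[ℂ] StrongDual ℂ W}
    (hd : ∀ ν : P, Continuous[weakStar d, weakStar d] fun μ => μ * ν) (h : A →ₙₐ[ℂ] P)
    (hc : ∀ a, h a ∈ topologicalCentre d) (hh : ∀ a, ‖h a‖ ≤ ‖a‖)
    (hm : IsDualMatrixNorm d) (hmul : CompletelyContractiveMul P)
    (hcc : ∀ {n : ℕ} (x : Matrix (Fin n) (Fin n) A), mnorm (x.map h) ≤ mnorm x) :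
    OpHLDBA.{u, v} A :=
  letI : OperatorSpace (weakStarClosureRange d hd h hc) :=
    OperatorSpace.comap (weakStarClosureRange.incl d hd h hc)
  letI : OperatorSpace (HLDBA.generated d hd h hc hh).Carrier :=
    OperatorSpace.comap (weakStarClosureRange.incl d hd h hc)
  { HLDBA.generated d hd h hc hh with
    opCarrier := OperatorSpace.comap (weakStarClosureRange.incl d hd h hc)
    opPredual := predualOperatorSpace (weakStarClosureRange.dual d hd h hc)
    mnorm_eq_dual := (isDualMatrixNorm_annihilatorDual hm _ _ _).mnorm_eq
    mul_cc := fun m n x y => hmul m n (x.map (weakStarClosureRange.incl d hd h hc))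
      (y.map (weakStarClosureRange.incl d hd h hc))
    η_cc := fun x => hcc x }

end OpGenerated

/-! ### The subdirect product and its universal property -/

section Subdirect

variable {A : Type u} [NonUnitalNormedRing A] [NormedSpace ℂ A] {I : Type w}
  (𝔄 : I → HLDBA.{u, v} A)

/-- The predual of the `ℓ^∞`-product. -/
abbrev HLDBA.productDual :
    HLDBA.Product 𝔄 ≃ₗᵢ[ℂ] StrongDual ℂ (lp (fun i => (𝔄 i).Predual) 1) :=
  lpDual fun i => (𝔄 i).dual

theorem HLDBA.weakStar_productDual :
    weakStar (HLDBA.productDual 𝔄) = HLDBA.productWeakStar 𝔄 :=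
  weakStar_eq_induced _

/-- `HLDBA.diagonal` as a homomorphism. -/
def HLDBA.diagonalHom : A →ₙₐ[ℂ] HLDBA.Product 𝔄 where
  toFun := HLDBA.diagonal 𝔄
  map_smul' c a := by ext i; exact map_smul (𝔄 i).η c a
  map_zero' := by ext i; exact map_zero (𝔄 i).η
  map_add' a b := by ext i; exact map_add (𝔄 i).η a b
  map_mul' a b := by ext i; exact map_mul (𝔄 i).η a b

theorem HLDBA.norm_diagonalHom_le (a : A) : ‖HLDBA.diagonalHom 𝔄 a‖ ≤ ‖a‖ :=
  lp.norm_le_of_forall_le (norm_nonneg _) fun i => (𝔄 i).η_contractive a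

theorem HLDBA.product_mul_weakStar (ν : HLDBA.Product 𝔄) :
    Continuous[weakStar (HLDBA.productDual 𝔄), weakStar (HLDBA.productDual 𝔄)]
      fun μ => μ * ν :=
  weakStar_continuous_lp _ _ (LinearMap.mulRight ℂ ν) (norm_nonneg ν)
    (fun μ => (norm_mul_le μ ν).trans_eq (mul_comm _ _)) fun i =>
    weakStar_comp ((𝔄 i).mul_weakStar (ν i)) (weakStar_continuous_lp_apply _ i)

theorem HLDBA.diagonalHom_mem_centre (a : A) :
    HLDBA.diagonalHom 𝔄 a ∈ topologicalCentre (HLDBA.productDual 𝔄) :=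
  weakStar_continuous_lp _ _ (LinearMap.mulLeft ℂ (HLDBA.diagonalHom 𝔄 a)) (norm_nonneg _)
    (fun μ => norm_mul_le _ μ) fun i =>
    weakStar_comp ((𝔄 i).η_mem_centre a) (weakStar_continuous_lp_apply _ i)

/-- The subdirect product, as a subalgebra of the `ℓ^∞`-product. -/
def HLDBA.subdirect : HLDBA.{u, max w v} A :=
  HLDBA.generated (HLDBA.productDual 𝔄) (HLDBA.product_mul_weakStar 𝔄) (HLDBA.diagonalHom 𝔄)
    (HLDBA.diagonalHom_mem_centre 𝔄) (HLDBA.norm_diagonalHom_le 𝔄)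

/-- The inclusion of the subdirect product into the `ℓ^∞`-product. -/
def HLDBA.subdirectIncl : (HLDBA.subdirect 𝔄).Carrier →ₗᵢ[ℂ] HLDBA.Product 𝔄 :=
  weakStarClosureRange.incl (HLDBA.productDual 𝔄) (HLDBA.product_mul_weakStar 𝔄)
    (HLDBA.diagonalHom 𝔄) (HLDBA.diagonalHom_mem_centre 𝔄)

/-- An HLDBA isomorphic to the subdirect product embeds into the `ℓ^∞`-product. -/
theorem HLDBA.isSubdirectEmbedding_of_isHom {𝔓 : HLDBA.{u, u} A}
    {Ψ : 𝔓.Carrier →ₗ[ℂ] (HLDBA.subdirect 𝔄).Carrier} (hΨ : 𝔓.IsHom (HLDBA.subdirect 𝔄) Ψ)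
    (hs : Function.Surjective Ψ) (hi : ∀ x, ‖Ψ x‖ = ‖x‖) :
    HLDBA.IsSubdirectEmbedding 𝔄 𝔓 ((HLDBA.subdirectIncl 𝔄).comp ⟨Ψ, hi⟩) where
  range_eq := by
    rw [← weakStar_productDual]
    refine Eq.trans ?_ (coe_weakStarClosureRange (HLDBA.productDual 𝔄)
      (HLDBA.product_mul_weakStar 𝔄) (HLDBA.diagonalHom 𝔄) (HLDBA.diagonalHom_mem_centre 𝔄))
    rw [LinearIsometry.coe_comp, Set.range_comp]
    have : Set.range (⟨Ψ, hi⟩ : 𝔓.Carrier →ₗᵢ[ℂ] (HLDBA.subdirect 𝔄).Carrier) = Set.univ :=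
      hs.range_eq
    rw [this, Set.image_univ]
    exact Subtype.range_val
  map_mul μ ν := congrArg (HLDBA.subdirectIncl 𝔄) (hΨ.map_mul μ ν)
  weakStar_eq := by
    -- One comparison of the topologies is the continuity of `Ψ`, the other that of its inverse.
    obtain ⟨Φ, hΦ, h1, -⟩ := hΨ.exists_inverse hs hi
    rw [← weakStar_productDual, LinearIsometry.coe_comp, ← induced_compose]
    have h2 : TopologicalSpace.induced (HLDBA.subdirectIncl 𝔄) (weakStar (productDual 𝔄)) =
        weakStar (HLDBA.subdirect 𝔄).dual :=
      (weakStarClosureRange.weakStar_dual _ _ _ _).symm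
    rw [h2]
    refine le_antisymm (continuous_iff_le_induced.1 hΨ.weakStar) ?_
    have h3 := continuous_iff_le_induced.1 hΦ.weakStar
    refine (induced_mono h3).trans (le_of_eq ?_)
    rw [induced_compose]
    have : Φ ∘ Ψ = id := funext h1
    exact (congrArg (fun f => TopologicalSpace.induced f (weakStar 𝔓.dual)) this).trans
      (@induced_id _ (weakStar 𝔓.dual))
  map_η a := congrArg (HLDBA.subdirectIncl 𝔄) (hΨ.comp_η a)

theorem HLDBA.exists_isSubdirectProduct : ∃ 𝔓, HLDBA.IsSubdirectProduct 𝔄 𝔓 := by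
  obtain ⟨Ψ, hΨ, hs, hi⟩ := HLDBA.Equiv.symm (HLDBA.subdirect 𝔄).exists_isHom_shrink
  exact ⟨_, _, HLDBA.isSubdirectEmbedding_of_isHom 𝔄 hΨ hs hi⟩

variable {𝔄}

theorem HLDBA.IsSubdirectEmbedding.isHom_coord {𝔓 : HLDBA.{u, u} A}
    {j : 𝔓.Carrier →ₗᵢ[ℂ] HLDBA.Product 𝔄} (h : HLDBA.IsSubdirectEmbedding 𝔄 𝔓 j) (i : I) :
    𝔓.IsHom (𝔄 i)
      { toFun := fun x => j x i
        map_add' := fun x y => by rw [map_add]; rfl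
        map_smul' := fun c x => by rw [map_smul]; rfl } where
  contractive x := (lp.norm_apply_le_norm ENNReal.top_ne_zero (j x) i).trans_eq (j.norm_map x)
  weakStar := by
    have h1 : Continuous[_root_.weakStar 𝔓.dual, _root_.weakStar (HLDBA.productDual 𝔄)] j := by
      rw [h.weakStar_eq, HLDBA.weakStar_productDual]
      exact continuous_induced_dom
    have h2 := weakStar_comp (weakStar_continuous_lp_apply (fun i => (𝔄 i).dual) i) h1
    exact h2
  comp_η a := by
    change j (𝔓.η a) i = _
    rw [h.map_η]
    rfl

/-- Homomorphisms into the factors lift to the subdirect product. -/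
theorem HLDBA.IsSubdirectEmbedding.exists_lift {𝔓 : HLDBA.{u, u} A}
    {j : 𝔓.Carrier →ₗᵢ[ℂ] HLDBA.Product 𝔄} (h : HLDBA.IsSubdirectEmbedding 𝔄 𝔓 j)
    {𝔅 : HLDBA.{u, u} A} {Φ : ∀ i, 𝔅.Carrier →ₗ[ℂ] (𝔄 i).Carrier}
    (hΦ : ∀ i, 𝔅.IsHom (𝔄 i) (Φ i)) :
    ∃ Ψ : 𝔅.Carrier →ₗ[ℂ] 𝔓.Carrier, 𝔅.IsHom 𝔓 Ψ ∧ ∀ x i, j (Ψ x) i = Φ i x := by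
  let T : 𝔅.Carrier →ₗ[ℂ] HLDBA.Product 𝔄 :=
    { toFun := fun x => ⟨fun i => Φ i x, memℓp_infty ⟨‖x‖, by
        rintro _ ⟨i, rfl⟩
        exact (hΦ i).contractive x⟩⟩
      map_add' := fun x y => by ext i; exact map_add (Φ i) x y
      map_smul' := fun c x => by ext i; exact map_smul (Φ i) c x }
  have hT : ∀ x, ‖T x‖ ≤ ‖x‖ := fun x =>
    lp.norm_le_of_forall_le (norm_nonneg _) fun i => (hΦ i).contractive x
  have hTw : Continuous[weakStar 𝔅.dual, weakStar (HLDBA.productDual 𝔄)] T :=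
    weakStar_continuous_lp _ _ T zero_le_one (fun x => (hT x).trans_eq (one_mul _).symm)
      fun i => (hΦ i).weakStar
  have hTη : ∀ a, T (𝔅.η a) = HLDBA.diagonal 𝔄 a := fun a => by
    ext i
    exact (hΦ i).comp_η a
  -- By continuity, `T` maps the closure of `η(A)` into the closure of the diagonal, which is the
  -- range of `j`.
  have hmem : ∀ x, T x ∈ Set.range j := by
    intro x
    rw [h.range_eq, ← HLDBA.weakStar_productDual]
    let := weakStar 𝔅.dual
    let := weakStar (HLDBA.productDual 𝔄)
    refine map_mem_closure hTw (𝔅.η_dense x) ?_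
    rintro _ ⟨a, rfl⟩
    exact ⟨a, (hTη a).symm⟩
  choose S hS using hmem
  refine ⟨{ toFun := S
            map_add' := fun x y => j.injective (by rw [hS, map_add, map_add, hS, hS])
            map_smul' := fun c x => j.injective (by
              rw [hS, map_smul, RingHom.id_apply, map_smul, hS]) }, ⟨fun x => ?_, ?_, fun a => ?_⟩,
    fun x i => ?_⟩
  · rw [← j.norm_map]
    exact (congrArg norm (hS x)).trans_le (hT x)
  · rw [h.weakStar_eq, ← HLDBA.weakStar_productDual]
    let := weakStar 𝔅.dual
    let := weakStar (HLDBA.productDual 𝔄)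
    refine continuous_induced_rng.2 ?_
    have : j ∘ S = T := funext hS
    exact (congrArg Continuous this).mpr hTw
  · apply j.injective
    rw [h.map_η]
    exact (hS _).trans (hTη a)
  · exact congrFun (congrArg Subtype.val (hS x)) i

end Subdirect

/-! ### Operator subdirect products -/

section OpSubdirect

variable {A : Type u} [NonUnitalNormedRing A] [NormedSpace ℂ A] [OperatorSpace A] {I : Type w}
  (𝔄 : I → OpHLDBA.{u, v} A)

/-- The operator space version of `HLDBA.subdirect`. -/
def OpHLDBA.subdirect : OpHLDBA.{u, max w v} A :=
  letI := lpOperatorSpace fun i => (𝔄 i).Carrier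
  OpHLDBA.generated (HLDBA.product_mul_weakStar fun i => (𝔄 i).toHLDBA)
    (HLDBA.diagonalHom fun i => (𝔄 i).toHLDBA)
    (HLDBA.diagonalHom_mem_centre fun i => (𝔄 i).toHLDBA)
    (HLDBA.norm_diagonalHom_le fun i => (𝔄 i).toHLDBA)
    (isDualMatrixNorm_lpDual fun i => isDualMatrixNorm_of_mnorm_eq (𝔄 i).mnorm_eq_dual)
    (completelyContractiveMul_lp fun i => (𝔄 i).mul_cc)
    fun x => Real.iSup_le (fun i => (𝔄 i).η_cc x) (mnorm_nonneg x)

theorem OpHLDBA.exists_isSubdirectProduct : ∃ 𝔓, OpHLDBA.IsSubdirectProduct 𝔄 𝔓 := by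
  obtain ⟨Ψ, hΨ, hs, hi⟩ := (OpHLDBA.subdirect 𝔄).equiv_shrink.symm
  have hi' : ∀ x, ‖Ψ x‖ = ‖x‖ := fun x => by
    rw [← mnorm_one, ← mnorm_one (E := (OpHLDBA.subdirect 𝔄).shrink.Carrier), ← hi]
    rfl
  have hΨ' : (OpHLDBA.subdirect 𝔄).shrink.toHLDBA.IsHom
    (HLDBA.subdirect fun i => (𝔄 i).toHLDBA) Ψ := hΨ.isHom
  exact ⟨_, _, HLDBA.isSubdirectEmbedding_of_isHom (fun i => (𝔄 i).toHLDBA) hΨ' hs hi',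
    fun x => (hi x).symm⟩

variable {𝔄}

/-- As the matrix norm is the supremum over the coordinates, each coordinate is completely
contractive, and the lift is so because all its coordinates are. -/
theorem OpHLDBA.isLeast_of_isSubdirectProduct {𝔓 : OpHLDBA.{u, u} A}
    (h : OpHLDBA.IsSubdirectProduct 𝔄 𝔓) :
    (∀ i, (𝔄 i).Le 𝔓) ∧ ∀ 𝔅 : OpHLDBA.{u, u} A, (∀ i, (𝔄 i).Le 𝔅) → 𝔓.Le 𝔅 := by
  obtain ⟨j, hj, hm⟩ := h
  refine ⟨fun i => ⟨_, hj.isHom_coord i, fun {n} x => ?_⟩, fun 𝔅 h𝔅 => ?_⟩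
  · rw [hm]
    exact mnorm_lpCoord_le (x.map j) i
  · choose Φ hΦ using h𝔅
    obtain ⟨Ψ, hΨ, hjΨ⟩ := hj.exists_lift fun i => (hΦ i).isHom
    refine ⟨Ψ, hΨ, fun {n} x => ?_⟩
    rw [hm]
    refine Real.iSup_le (fun i => ?_) (mnorm_nonneg x)
    refine le_of_eq_of_le (congrArg mnorm ?_) ((hΦ i).cc x)
    ext k l
    exact hjΨ _ i

end OpSubdirect

theorem HLDBA.isLeast_of_isSubdirectProduct {A : Type u} [NonUnitalNormedRing A] [NormedSpace ℂ A]
    {I : Type w} {𝔄 : I → HLDBA.{u, v} A} {𝔓 : HLDBA.{u, u} A}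
    (h : HLDBA.IsSubdirectProduct 𝔄 𝔓) :
    (∀ i, (𝔄 i).Le 𝔓) ∧ ∀ 𝔅 : HLDBA.{u, u} A, (∀ i, (𝔄 i).Le 𝔅) → 𝔓.Le 𝔅 := by
  obtain ⟨j, hj⟩ := h
  refine ⟨fun i => ⟨_, hj.isHom_coord i⟩, fun 𝔅 h𝔅 => ?_⟩
  choose Φ hΦ using h𝔅
  obtain ⟨Ψ, hΨ, -⟩ := hj.exists_lift hΦ
  exact ⟨Ψ, hΨ⟩

/-! ### The bidual -/

/-- An HLDBA on the dual of a Banach space. -/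
def HLDBA.ofPredual {A : Type u} [NonUnitalNormedRing A] [NormedSpace ℂ A] (X : Type v)
    [NormedAddCommGroup X] [NormedSpace ℂ X] [CompleteSpace X]
    (m : StrongDual ℂ X →ₗ[ℂ] StrongDual ℂ X →ₗ[ℂ] StrongDual ℂ X)
    (m_assoc : ∀ μ ν ξ, m (m μ ν) ξ = m μ (m ν ξ)) (norm_m_le : ∀ μ ν, ‖m μ ν‖ ≤ ‖μ‖ * ‖ν‖)
    (m_right : ∀ ν x, ∃ y, ∀ μ, m μ ν x = μ y) (h : A →ₗ[ℂ] StrongDual ℂ X)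
    (h_mul : ∀ a b, h (a * b) = m (h a) (h b)) (norm_h_le : ∀ a, ‖h a‖ ≤ ‖a‖)
    (m_left : ∀ a x, ∃ y, ∀ ν, m (h a) ν x = ν y) (h_sep : ∀ x, (∀ a, h a x = 0) → x = 0) :
    HLDBA.{u, v} A :=
  let d : StrongDual ℂ X ≃ₗᵢ[ℂ] StrongDual ℂ X := LinearIsometryEquiv.refl ℂ _
  have hcont : ∀ f : StrongDual ℂ X → StrongDual ℂ X, (∀ x, ∃ y, ∀ μ, f μ x = μ y) →
      Continuous[weakStar d, weakStar d] f := fun f hf => by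
    rw [weakStar_continuous_iff]
    intro x
    obtain ⟨y, hy⟩ := hf x
    exact (congrArg Continuous[weakStar d, inferInstance] (funext hy)).mpr (weakStar_eval d y)
  -- The range of `h` separates the points of `X`, so its preannihilator is zero and Hahn–Banach
  -- gives density.
  have hdense : @Dense _ (weakStar d) (Set.range h) := fun μ =>
    mem_weakStar_closure d (LinearMap.range h) μ fun x hx => by
      rw [h_sep x fun a => hx _ ⟨a, rfl⟩, map_zero]
  letI : NonUnitalNormedRing (StrongDual ℂ X) :=
    { (inferInstance : NormedAddCommGroup (StrongDual ℂ X)) with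
      mul := fun μ ν => m μ ν
      left_distrib := fun μ ν ξ => map_add (m μ) ν ξ
      right_distrib := fun μ ν ξ => LinearMap.map_add₂ m μ ν ξ
      zero_mul := fun μ => LinearMap.map_zero₂ m μ
      mul_zero := fun μ => map_zero (m μ)
      mul_assoc := m_assoc
      norm_mul_le := norm_m_le }
  { Carrier := StrongDual ℂ X
    Predual := X
    normedSpace := inferInstanceAs (NormedSpace ℂ (X →L[ℂ] ℂ))
    isScalarTower := ⟨fun c μ ν => LinearMap.map_smul₂ m c μ ν⟩
    smulCommClass := ⟨fun c μ ν => (map_smul (m μ) c ν).symm⟩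
    dual := d
    mul_weakStar := fun ν => hcont (fun μ => m μ ν) (m_right ν)
    η :=
      { toFun := h
        map_smul' := fun c a => h.map_smul c a
        map_zero' := h.map_zero
        map_add' := h.map_add
        map_mul' := h_mul }
    η_contractive := norm_h_le
    η_mem_centre := fun a => hcont (fun ν => m (h a) ν) (m_left a)
    η_dense := hdense }

/-! ### The bidual with the first Arens product -/

section BidualExists

variable {A : Type u} [NonUnitalNormedRing A] [NormedSpace ℂ A] [IsScalarTower ℂ A A]
  [SMulCommClass ℂ A A]

theorem arensMul_apply (μ ν : StrongDual ℂ (StrongDual ℂ A)) (φ : StrongDual ℂ A) :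
    arensMul μ ν φ = μ (arensAct ν φ) := rfl

theorem arensAct_add (μ ν : StrongDual ℂ (StrongDual ℂ A)) (φ : StrongDual ℂ A) :
    arensAct (μ + ν) φ = arensAct μ φ + arensAct ν φ := rfl

theorem arensAct_smul (c : ℂ) (ν : StrongDual ℂ (StrongDual ℂ A)) (φ : StrongDual ℂ A) :
    arensAct (c • ν) φ = c • arensAct ν φ := rfl

/-- This is associativity of `A`, seen as commutation of the left action of `A**` on `A*` with the
right action of `A`. -/
theorem arensAct_comp_mul (ν : StrongDual ℂ (StrongDual ℂ A)) (φ : StrongDual ℂ A) (a : A) :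
    arensAct ν (φ ∘L ContinuousLinearMap.mul ℂ A a) =
      arensAct ν φ ∘L ContinuousLinearMap.mul ℂ A a := by
  ext b
  rw [arensAct_apply, ContinuousLinearMap.comp_apply, arensAct_apply]
  congr 1
  ext c
  simp [mul_assoc]

/-- `A*` is a left module over `A**`; associativity of the Arens product is the dual statement. -/
theorem arensAct_arensMul (μ ν : StrongDual ℂ (StrongDual ℂ A)) (φ : StrongDual ℂ A) :
    arensAct (arensMul μ ν) φ = arensAct μ (arensAct ν φ) := by
  ext a
  rw [arensAct_apply, arensMul_apply, arensAct_comp_mul, arensAct_apply]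

theorem norm_arensAct_le (ν : StrongDual ℂ (StrongDual ℂ A)) (φ : StrongDual ℂ A) :
    ‖arensAct ν φ‖ ≤ ‖ν‖ * ‖φ‖ := by
  refine ContinuousLinearMap.opNorm_le_bound _ (by positivity) fun a => ?_
  rw [arensAct_apply, mul_assoc]
  refine (ν.le_opNorm _).trans (mul_le_mul_of_nonneg_left ?_ (norm_nonneg _))
  refine ContinuousLinearMap.opNorm_le_bound _ (by positivity) fun b => ?_
  refine (φ.le_opNorm _).trans ?_
  rw [mul_assoc]
  exact mul_le_mul_of_nonneg_left (norm_mul_le a b) (norm_nonneg _)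

theorem norm_arensMul_le (μ ν : StrongDual ℂ (StrongDual ℂ A)) :
    ‖arensMul μ ν‖ ≤ ‖μ‖ * ‖ν‖ := by
  refine ContinuousLinearMap.opNorm_le_bound _ (by positivity) fun φ => ?_
  rw [arensMul_apply, mul_assoc]
  exact (μ.le_opNorm _).trans (mul_le_mul_of_nonneg_left (norm_arensAct_le ν φ) (norm_nonneg _))

variable (A) in
/-- The first Arens product as a bilinear map. -/
def arensMulBilin : StrongDual ℂ (StrongDual ℂ A) →ₗ[ℂ] StrongDual ℂ (StrongDual ℂ A) →ₗ[ℂ]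
    StrongDual ℂ (StrongDual ℂ A) :=
  LinearMap.mk₂ ℂ arensMul (fun _ _ _ => rfl) (fun _ _ _ => rfl)
    (fun μ ν ξ => by
      ext φ
      exact (congrArg μ (arensAct_add ν ξ φ)).trans (map_add μ _ _))
    (fun c μ ν => by
      ext φ
      exact (congrArg μ (arensAct_smul c ν φ)).trans (map_smul μ _ _))

variable (A) in
/-- The bidual of `A`, as an HLDBA. -/
def HLDBA.bidual : HLDBA.{u, u} A :=
  HLDBA.ofPredual (StrongDual ℂ A) (arensMulBilin A)
    (fun μ ν ξ => by
      ext φ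
      exact (congrArg μ (arensAct_arensMul ν ξ φ)).symm)
    norm_arensMul_le (fun ν φ => ⟨arensAct ν φ, fun _ => rfl⟩)
    (NormedSpace.inclusionInDoubleDual ℂ A).toLinearMap (fun _ _ => rfl)
    (NormedSpace.double_dual_bound ℂ A)
    (fun a φ => ⟨φ ∘L ContinuousLinearMap.mul ℂ A a, fun _ => rfl⟩)
    (fun φ hφ => by
      ext a
      exact hφ a)

theorem HLDBA.isBidualVia_bidual : (HLDBA.bidual A).IsBidualVia (LinearIsometryEquiv.refl ℂ _)
    (LinearIsometryEquiv.refl ℂ _) where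
  pairing _ _ := rfl
  map_mul _ _ := rfl
  map_η _ := rfl

/-- Reassociating a threefold index converts a product matrix tested by a third factor into its
first factor tested by a combination of the other two. Each definition in the Arens product is such
a shift. -/
theorem scalarOpNorm_of_assoc {m n k : ℕ}
    (F : Fin m → Fin m → Fin n → Fin n → Fin k → Fin k → ℂ) :
    scalarOpNorm (Matrix.of fun p q : Fin (m * n) × Fin k =>
      F (finProdFinEquiv.symm p.1).1 (finProdFinEquiv.symm q.1).1
        (finProdFinEquiv.symm p.1).2 (finProdFinEquiv.symm q.1).2 p.2 q.2) =
    scalarOpNorm (Matrix.of fun p q : Fin m × Fin (n * k) =>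
      F p.1 q.1 (finProdFinEquiv.symm p.2).1 (finProdFinEquiv.symm q.2).1
        (finProdFinEquiv.symm p.2).2 (finProdFinEquiv.symm q.2).2) := by
  let e : Fin (m * n) × Fin k ≃ Fin m × Fin (n * k) :=
    ((finProdFinEquiv.symm.prodCongr (Equiv.refl _)).trans (Equiv.prodAssoc _ _ _)).trans
      ((Equiv.refl _).prodCongr finProdFinEquiv)
  rw [← scalarOpNorm_submatrix_equiv (Matrix.of fun p q : Fin m × Fin (n * k) =>
      F p.1 q.1 (finProdFinEquiv.symm p.2).1 (finProdFinEquiv.symm q.2).1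
        (finProdFinEquiv.symm p.2).2 (finProdFinEquiv.symm q.2).2) e e]
  congr 1
  ext p q
  simp only [e, Matrix.of_apply, Matrix.submatrix_apply, Equiv.trans_apply, Equiv.prodCongr_apply,
    Prod.map, Equiv.prodAssoc_apply, Equiv.refl_apply, Equiv.symm_apply_apply]

theorem scalarOpNorm_pairing_le_one {E : Type*} [NormedAddCommGroup E] [NormedSpace ℂ E]
    [OperatorSpace E] {n m : ℕ} {f : Matrix (Fin n) (Fin n) (StrongDual ℂ E)}
    {x : Matrix (Fin m) (Fin m) E} (hf : dualMNorm f ≤ 1) (hx : mnorm x ≤ 1) :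
    scalarOpNorm (Matrix.of fun p q : Fin n × Fin m => f p.1 q.1 (x p.2 q.2)) ≤ 1 :=
  (scalarOpNorm_pairing_le_of_le_one f hx).trans hf

variable [OperatorSpace A]

/-- Testing `φ · a` on `b` is testing `φ` on the product of `a` and `b`, which is contractive by
hypothesis. `dualMNorm_arensAct_le` and `dualMNorm_arensMul_le` repeat the argument one dual higher
each. -/
theorem dualMNorm_comp_mul_le (hA : CompletelyContractiveMul A) {k l : ℕ}
    {φ : Matrix (Fin k) (Fin k) (StrongDual ℂ A)} {a : Matrix (Fin l) (Fin l) A}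
    (hφ : dualMNorm φ ≤ 1) (ha : mnorm a ≤ 1) :
    dualMNorm (Matrix.of fun p q : Fin (k * l) =>
      φ (finProdFinEquiv.symm p).1 (finProdFinEquiv.symm q).1 ∘L
        ContinuousLinearMap.mul ℂ A
          (a (finProdFinEquiv.symm p).2 (finProdFinEquiv.symm q).2)) ≤ 1 := by
  refine dualMNorm_le zero_le_one fun t b hb => ?_
  have h := scalarOpNorm_pairing_le_one hφ
    ((hA l t a b).trans (mul_le_one₀ ha (mnorm_nonneg _) hb))
  exact (scalarOpNorm_of_assoc fun i j i' j' i'' j'' => φ i j (a i' j' * b i'' j'')).trans_le h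

theorem dualMNorm_arensAct_le (hA : CompletelyContractiveMul A) {n k : ℕ}
    (y : Matrix (Fin n) (Fin n) (StrongDual ℂ (StrongDual ℂ A)))
    {φ : Matrix (Fin k) (Fin k) (StrongDual ℂ A)} (hφ : dualMNorm φ ≤ 1) :
    dualMNorm (Matrix.of fun p q : Fin (n * k) =>
      arensAct (y (finProdFinEquiv.symm p).1 (finProdFinEquiv.symm q).1)
        (φ (finProdFinEquiv.symm p).2 (finProdFinEquiv.symm q).2)) ≤
      @dualMNorm _ _ _ (dualOperatorSpace A) _ y := by
  let := dualOperatorSpace A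
  refine dualMNorm_le (dualMNorm_nonneg y) fun l a ha => ?_
  have h := scalarOpNorm_pairing_le_of_le_one y (dualMNorm_comp_mul_le hA hφ ha)
  exact (scalarOpNorm_of_assoc fun i j i' j' i'' j'' =>
    y i j (φ i' j' ∘L ContinuousLinearMap.mul ℂ A (a i'' j''))).trans_le h

theorem dualMNorm_arensMul_le (hA : CompletelyContractiveMul A) {m n : ℕ}
    (x : Matrix (Fin m) (Fin m) (StrongDual ℂ (StrongDual ℂ A)))
    (y : Matrix (Fin n) (Fin n) (StrongDual ℂ (StrongDual ℂ A))) :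
    @dualMNorm _ _ _ (dualOperatorSpace A) _ (Matrix.of fun p q : Fin (m * n) =>
      arensMul (x (finProdFinEquiv.symm p).1 (finProdFinEquiv.symm q).1)
        (y (finProdFinEquiv.symm p).2 (finProdFinEquiv.symm q).2)) ≤
      @dualMNorm _ _ _ (dualOperatorSpace A) _ x *
        @dualMNorm _ _ _ (dualOperatorSpace A) _ y := by
  let := dualOperatorSpace A
  refine dualMNorm_le (mul_nonneg (dualMNorm_nonneg x) (dualMNorm_nonneg y)) fun k φ hφ => ?_
  have h := (scalarOpNorm_pairing_le x _).trans
    (mul_le_mul_of_nonneg_left (dualMNorm_arensAct_le hA y hφ) (dualMNorm_nonneg x))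
  exact (scalarOpNorm_of_assoc fun i j i' j' i'' j'' =>
    x i j (arensAct (y i' j') (φ i'' j''))).trans_le h

omit [IsScalarTower ℂ A A] [SMulCommClass ℂ A A] in
theorem dualMNorm_inclusionInDoubleDual_le {n : ℕ} (a : Matrix (Fin n) (Fin n) A) :
    @dualMNorm _ _ _ (dualOperatorSpace A) _ (a.map (NormedSpace.inclusionInDoubleDual ℂ A)) ≤
      mnorm a := by
  let := dualOperatorSpace A
  refine dualMNorm_le (mnorm_nonneg a) fun k φ hφ => ?_
  have h := (scalarOpNorm_pairing_le φ a).trans (mul_le_of_le_one_left (mnorm_nonneg a) hφ)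
  exact (scalarOpNorm_of_swap fun i j i' j' => φ i' j' (a i j)).trans_le h

variable (A) in
/-- The bidual of `A`, as an operator HLDBA. -/
def OpHLDBA.bidual (hA : CompletelyContractiveMul A) : OpHLDBA.{u, u} A :=
  { HLDBA.bidual A with
    opCarrier := @dualOperatorSpace (StrongDual ℂ A) _ _ (dualOperatorSpace A)
    opPredual := dualOperatorSpace A
    mnorm_eq_dual := fun _ => rfl
    mul_cc := fun _ _ x y => dualMNorm_arensMul_le hA x y
    η_cc := dualMNorm_inclusionInDoubleDual_le }

theorem OpHLDBA.isBidual_bidual (hA : CompletelyContractiveMul A) :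
    (OpHLDBA.bidual A hA).IsBidual :=
  ⟨LinearIsometryEquiv.refl ℂ _, LinearIsometryEquiv.refl ℂ _, HLDBA.isBidualVia_bidual,
    fun _ => rfl⟩

end BidualExists

/-! ### Maximality of the bidual -/

section BidualTop

variable {A : Type u} [NonUnitalNormedRing A] [NormedSpace ℂ A] [IsScalarTower ℂ A A]
  [SMulCommClass ℂ A A]

/-- The bidual maps onto every HLDBA by the adjoint of `HLDBA.preadjoint`. -/
theorem HLDBA.IsBidualVia.exists_isHom {𝔗 : HLDBA.{u, u} A}
    {e : 𝔗.Predual ≃ₗᵢ[ℂ] StrongDual ℂ A} {J : 𝔗.Carrier ≃ₗᵢ[ℂ] StrongDual ℂ (StrongDual ℂ A)}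
    (h : 𝔗.IsBidualVia e J) (𝔄 : HLDBA.{u, v} A) :
    ∃ Φ : 𝔗.Carrier →ₗ[ℂ] 𝔄.Carrier, 𝔗.IsHom 𝔄 Φ ∧
      ∀ μ v, 𝔄.dual (Φ μ) v = 𝔗.dual μ (e.symm (𝔄.preadjoint v)) := by
  -- `R` is the pre-adjoint of `η`, read in the predual of `𝔗`; its adjoint `Φ` is therefore
  -- weak*-continuous and contractive.
  let R : 𝔄.Predual →L[ℂ] 𝔗.Predual :=
    LinearMap.mkContinuous (e.symm.toLinearEquiv.toLinearMap ∘ₗ 𝔄.preadjoint) 1 fun v => by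
      rw [one_mul]
      exact (e.symm.norm_map _).trans_le (𝔄.norm_preadjoint_le v)
  have hR : ‖R‖ ≤ 1 := LinearMap.mkContinuous_norm_le _ zero_le_one _
  let Φ : 𝔗.Carrier →ₗ[ℂ] 𝔄.Carrier :=
    { toFun := fun μ => 𝔄.dual.symm (𝔗.dual μ ∘L R)
      map_add' := fun μ ν => by rw [map_add, ContinuousLinearMap.add_comp, map_add]
      map_smul' := fun c μ => by
        rw [map_smul, ContinuousLinearMap.smul_comp, map_smul, RingHom.id_apply] }
  have hΦ : ∀ μ v, 𝔄.dual (Φ μ) v = 𝔗.dual μ (e.symm (𝔄.preadjoint v)) := fun μ v =>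
    DFunLike.congr_fun (𝔄.dual.apply_symm_apply (𝔗.dual μ ∘L R)) v
  refine ⟨Φ, ⟨fun μ => ?_, ?_, fun a => ?_⟩, hΦ⟩
  · refine (𝔄.dual.symm.norm_map _).trans_le ((ContinuousLinearMap.opNorm_comp_le _ _).trans ?_)
    rw [LinearIsometryEquiv.norm_map]
    exact mul_le_of_le_one_right (norm_nonneg _) hR
  · rw [weakStar_continuous_iff]
    intro v
    simp only [hΦ]
    exact weakStar_eval 𝔗.dual _
  · apply 𝔄.dual.injective
    ext v
    rw [hΦ, ← h.pairing, LinearIsometryEquiv.apply_symm_apply, h.map_η]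
    rfl

theorem HLDBA.IsBidual.le {𝔗 : HLDBA.{u, u} A} (h : 𝔗.IsBidual) (𝔄 : HLDBA.{u, v} A) :
    𝔄.Le 𝔗 := by
  obtain ⟨e, J, h⟩ := h
  obtain ⟨Φ, hΦ, -⟩ := h.exists_isHom 𝔄
  exact ⟨Φ, hΦ⟩

theorem OpHLDBA.IsBidual.le [OperatorSpace A] {𝔗 : OpHLDBA.{u, u} A} (h : 𝔗.IsBidual)
    (𝔄 : OpHLDBA.{u, v} A) : 𝔄.Le 𝔗 := by
  obtain ⟨e, J, h, hm⟩ := h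
  obtain ⟨Φ, hΦ, hdual⟩ := h.exists_isHom 𝔄.toHLDBA
  refine ⟨Φ, hΦ, fun {n} x => ?_⟩
  rw [𝔄.mnorm_eq_dual, 𝔗.mnorm_eq_dual]
  refine dualMNorm_le (dualMNorm_nonneg _) fun m v hv => ?_
  -- The pre-adjoint is completely contractive since `η` is: pairing it with `a` amounts to pairing
  -- `η(a)` with `v`. Its adjoint inherits this.
  have hpre : mnorm (v.map fun w => e.symm (𝔄.preadjoint w)) ≤ 1 := by
    rw [hm]
    refine dualMNorm_le zero_le_one fun k a ha => ?_
    simp only [Matrix.map_apply, LinearIsometryEquiv.apply_symm_apply]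
    refine (scalarOpNorm_of_swap fun i j i' j' => 𝔄.dual (𝔄.η (a i' j')) (v i j)).trans_le ?_
    refine scalarOpNorm_pairing_le_one (f := (a.map 𝔄.η).map 𝔄.dual) ?_ hv
    rw [← 𝔄.mnorm_eq_dual]
    exact (𝔄.η_cc a).trans ha
  refine le_of_eq_of_le ?_ (scalarOpNorm_pairing_le_of_le_one (x.map 𝔗.dual) hpre)
  congr 1
  ext p q
  exact hdual _ _

end BidualTop

/-! ### The complete lattices -/

section Lattice

variable {A : Type u} [NonUnitalNormedRing A] [NormedSpace ℂ A]

theorem HLDBA.IsSubdirectProduct.isLUB {I : Type w} {𝔄 : I → HLDBA.{u, u} A} {𝔓 : HLDBA.{u, u} A}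
    (h : HLDBA.IsSubdirectProduct 𝔄 𝔓) : IsLUB (Set.range fun i => (𝔄 i).toHLD) 𝔓.toHLD := by
  obtain ⟨h1, h2⟩ := HLDBA.isLeast_of_isSubdirectProduct h
  refine ⟨?_, fun y hy => ?_⟩
  · rintro _ ⟨i, rfl⟩
    exact h1 i
  · induction y using Quotient.ind with
    | _ 𝔅 => exact h2 𝔅 fun i => hy ⟨i, rfl⟩

variable (A) in
/-- The partial order of `HLD A`. -/
@[reducible] def HLD.partialOrder : PartialOrder (HLD A) where
  le := HLD.Le
  le_refl x := by
    induction x using Quotient.ind with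
    | _ 𝔄 => exact HLDBA.Le.refl 𝔄
  le_trans x y z := by
    induction x using Quotient.ind
    induction y using Quotient.ind
    induction z using Quotient.ind
    exact HLDBA.Le.trans
  le_antisymm x y h h' := by
    induction x using Quotient.ind
    induction y using Quotient.ind
    exact Quotient.sound (HLDBA.Le.antisymm h h')

/-- The representatives are indexed by a set of classes, which lives one universe above `A`; the
subdirect product returns to the universe of `A` because HLDBAs are small. -/
theorem HLD.exists_isLUB (s : Set (HLD A)) : ∃ x, IsLUB s x := by
  obtain ⟨𝔓, h𝔓⟩ := HLDBA.exists_isSubdirectProduct fun i : s => i.1.out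
  refine ⟨𝔓.toHLD, ?_⟩
  have h := h𝔓.isLUB
  have hs : (Set.range fun i : s => (i.1.out : HLDBA.{u, u} A).toHLD) = s := by
    have : (fun i : s => (i.1.out : HLDBA.{u, u} A).toHLD) = Subtype.val :=
      funext fun i => Quotient.out_eq i.1
    rw [this, Subtype.range_val]
  rwa [hs] at h

/-- Arbitrary suprema suffice, as an infimum is the supremum of the lower bounds. The extreme
elements are identified by antisymmetry. -/
theorem HLD.exists_completeLattice [IsScalarTower ℂ A A] [SMulCommClass ℂ A A] :
    ∃ L : CompleteLattice (HLD A), (∀ x y : HLD A, L.le x y ↔ HLD.Le x y) ∧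
      (∀ 𝔗 : HLDBA.{u, u} A, 𝔗.IsBidual → L.top = 𝔗.toHLD) ∧
      L.bot = (HLDBA.trivial A).toHLD := by
  let := HLD.partialOrder A
  choose S hS using HLD.exists_isLUB (A := A)
  let : SupSet (HLD A) := ⟨S⟩
  let L := completeLatticeOfSup (HLD A) hS
  refine ⟨L, fun _ _ => Iff.rfl, fun 𝔗 h𝔗 => ?_, ?_⟩
  · refine le_antisymm ?_ (L.le_top _)
    induction L.top using Quotient.ind with
    | _ 𝔄 => exact h𝔗.le 𝔄
  · refine le_antisymm (L.bot_le _) ?_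
    induction L.bot using Quotient.ind with
    | _ 𝔄 => exact HLDBA.trivial_le 𝔄

variable [OperatorSpace A]

theorem OpHLDBA.IsSubdirectProduct.isLUB {I : Type w} {𝔄 : I → OpHLDBA.{u, u} A}
    {𝔓 : OpHLDBA.{u, u} A} (h : OpHLDBA.IsSubdirectProduct 𝔄 𝔓) :
    IsLUB (Set.range fun i => (𝔄 i).toOpHLD) 𝔓.toOpHLD := by
  obtain ⟨h1, h2⟩ := OpHLDBA.isLeast_of_isSubdirectProduct h
  refine ⟨?_, fun y hy => ?_⟩
  · rintro _ ⟨i, rfl⟩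
    exact h1 i
  · induction y using Quotient.ind with
    | _ 𝔅 => exact h2 𝔅 fun i => hy ⟨i, rfl⟩

variable (A) in
/-- The partial order of `OpHLD A`. -/
@[reducible] def OpHLD.partialOrder : PartialOrder (OpHLD A) where
  le := OpHLD.Le
  le_refl x := by
    induction x using Quotient.ind with
    | _ 𝔄 => exact (OpHLDBA.Equiv.refl 𝔄).ge
  le_trans x y z := by
    induction x using Quotient.ind
    induction y using Quotient.ind
    induction z using Quotient.ind
    exact OpHLDBA.Le.trans
  le_antisymm x y h h' := by
    induction x using Quotient.ind
    induction y using Quotient.ind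
    exact Quotient.sound (OpHLDBA.Le.antisymm h h')

theorem OpHLD.exists_isLUB (s : Set (OpHLD A)) : ∃ x, IsLUB s x := by
  obtain ⟨𝔓, h𝔓⟩ := OpHLDBA.exists_isSubdirectProduct fun i : s => i.1.out
  refine ⟨𝔓.toOpHLD, ?_⟩
  have h := h𝔓.isLUB
  have hs : (Set.range fun i : s => (i.1.out : OpHLDBA.{u, u} A).toOpHLD) = s := by
    have : (fun i : s => (i.1.out : OpHLDBA.{u, u} A).toOpHLD) = Subtype.val :=
      funext fun i => Quotient.out_eq i.1
    rw [this, Subtype.range_val]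
  rwa [hs] at h

theorem OpHLD.exists_completeLattice [IsScalarTower ℂ A A] [SMulCommClass ℂ A A] :
    ∃ L : CompleteLattice (OpHLD A), (∀ x y : OpHLD A, L.le x y ↔ OpHLD.Le x y) ∧
      (∀ 𝔗 : OpHLDBA.{u, u} A, 𝔗.IsBidual → L.top = 𝔗.toOpHLD) ∧
      L.bot = (OpHLDBA.trivial A).toOpHLD := by
  let := OpHLD.partialOrder A
  choose S hS using OpHLD.exists_isLUB (A := A)
  let : SupSet (OpHLD A) := ⟨S⟩
  let L := completeLatticeOfSup (OpHLD A) hS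
  refine ⟨L, fun _ _ => Iff.rfl, fun 𝔗 h𝔗 => ?_, ?_⟩
  · refine le_antisymm ?_ (L.le_top _)
    induction L.top using Quotient.ind with
    | _ 𝔄 => exact h𝔗.le 𝔄
  · refine le_antisymm (L.bot_le _) ?_
    induction L.bot using Quotient.ind with
    | _ 𝔄 => exact OpHLDBA.trivial_le 𝔄

end Lattice

end

/-- The clauses on HLDBAs in an arbitrary universe express that the classes form a set: those in the
universe of `A` already represent all of them. -/
theorem mainTheorem2 (A : Type u) [NonUnitalNormedRing A] [NormedSpace ℂ A]
    [IsScalarTower ℂ A A] [SMulCommClass ℂ A A] [CompleteSpace A] :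
    -- Banach algebra version
    ((∀ 𝔄 : HLDBA.{u, v} A, ∃ 𝔅 : HLDBA.{u, u} A, 𝔄.Equiv 𝔅) ∧
      (∀ (I : Type w) (𝔄 : I → HLDBA.{u, u} A),
        (∃ 𝔓, HLDBA.IsSubdirectProduct 𝔄 𝔓) ∧
        ∀ 𝔓, HLDBA.IsSubdirectProduct 𝔄 𝔓 → IsLUB (Set.range fun i => (𝔄 i).toHLD) 𝔓.toHLD) ∧
      (∃ 𝔗 : HLDBA.{u, u} A, 𝔗.IsBidual) ∧
      ∃ L : CompleteLattice (HLD A),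
        (∀ x y : HLD A, L.le x y ↔ HLD.Le x y) ∧
        (∀ 𝔗 : HLDBA.{u, u} A, 𝔗.IsBidual → L.top = 𝔗.toHLD) ∧
        L.bot = (HLDBA.trivial A).toHLD) ∧
    -- operator space version
    (∀ [OperatorSpace A], CompletelyContractiveMul A →
      (∀ 𝔄 : OpHLDBA.{u, v} A, ∃ 𝔅 : OpHLDBA.{u, u} A, 𝔄.Equiv 𝔅) ∧
      (∀ (I : Type w) (𝔄 : I → OpHLDBA.{u, u} A),
        (∃ 𝔓, OpHLDBA.IsSubdirectProduct 𝔄 𝔓) ∧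
        ∀ 𝔓, OpHLDBA.IsSubdirectProduct 𝔄 𝔓 →
          IsLUB (Set.range fun i => (𝔄 i).toOpHLD) 𝔓.toOpHLD) ∧
      (∃ 𝔗 : OpHLDBA.{u, u} A, 𝔗.IsBidual) ∧
      ∃ L : CompleteLattice (OpHLD A),
        (∀ x y : OpHLD A, L.le x y ↔ OpHLD.Le x y) ∧
        (∀ 𝔗 : OpHLDBA.{u, u} A, 𝔗.IsBidual → L.top = 𝔗.toOpHLD) ∧
        L.bot = (OpHLDBA.trivial A).toOpHLD) := by
  refine ⟨⟨fun 𝔄 => ⟨_, 𝔄.exists_isHom_shrink⟩, fun I 𝔄 =>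
      ⟨HLDBA.exists_isSubdirectProduct 𝔄, fun _ h => h.isLUB⟩,
      ⟨HLDBA.bidual A, _, _, HLDBA.isBidualVia_bidual⟩, HLD.exists_completeLattice⟩,
    fun hA => ⟨fun 𝔄 => ⟨_, 𝔄.equiv_shrink⟩, fun I 𝔄 =>
      ⟨OpHLDBA.exists_isSubdirectProduct 𝔄, fun _ h => h.isLUB⟩,
      ⟨OpHLDBA.bidual A hA, OpHLDBA.isBidual_bidual hA⟩, OpHLD.exists_completeLattice⟩⟩
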